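/- Let $k\ge 1$ be an integer, let $V=\{0,\dots,k\}$, and let $R,S_1,\dots,S_k,T$ be pairwise distinct predicates, $R,T$ unary and $S_1,\dots,S_k$ binary. Put $h_{k,0}=\exists x\exists y\,(R(x)\wedge S_1(x,y))$, $h_{k,i}=\exists x\exists y\,(S_i(x,y)\wedge S_{i+1}(x,y))$ for $1\le i<k$, and $h_{k,k}=\exists x\exists y\,(S_k(x,y)\wedge T(y))$. For a Boolean function $\varphi:2^V\to\{0,1\}$, let $Q_\varphi$ be the Boolean query obtained from $\varphi$ by replacing each variable $i\in V$ by $h_{k,i}$, and let $\mathrm{eul}(\varphi)=\sum_{\nu\subseteq V,\ \varphi(\nu)=1}(-1)^{|\nu|}$. For a Boolean query $Q$, $\mathrm{PQE}(Q)$ is the following problem: given a finite database $D$ over $R,S_1,\dots,S_k,T$ and rational probabilities $\pi(t)\in[0,1]$ for $t\in D$, compute $$\sum_{D'\subseteq D,\ D'\models Q}\ \prod_{t\in D'}\pi(t)\prod_{t\in D\setminus D'}(1-\pi(t)).$$ The lineage of $Q$ on $D$ is the Boolean function on the set of variables $D$ that maps $D'\subseteq D$ to true iff $D'\models Q$. A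 d-D is a Boolean circuit with variable gates, $\neg$-gates, and $\wedge$- and $\vee$-gates of unbounded (possibly zero) fan-in, in which distinct inputs of an $\wedge$-gate depend on disjoint sets of variables (there is a directed path to them from variable gates of disjoint sets of variables) and distinct inputs of an $\vee$-gate capture Boolean functions that are never true simultaneously. We say that $Q$ has d-Ds computable in PTIME if some polynomial-time algorithm maps every database $D$ to a d-D that represents the lineage of $Q$ on $D$, and that $Q$ has polynomial-size d-Ds if there is a polynomial $b$ such that, for every database $D$, the lineage of $Q$ on $D$ is represented by some d-D with at most $b(|D|)$ gates and wires in total. **Theorem.** Let $\varphi,\varphi'$ be Boolean functions on $V$ (not necessarily monotone) with $\mathrm{eul}(\varphi)=\mathrm{eul}(\varphi')$. Then: (a) $\mathrm{PQE}(Q_\varphi)$ and $\mathrm{PQE}(Q_{\varphi'})$ are equivalent under polynomial-time Turing reductions; (b) $Q_\varphi$ has d-Ds computable in PTIME if and only if $Q_{\varphi'}$ does; (c) $Q_\varphi$ has polynomial-size d-Ds if and only if $Q_{\varphi'}$ does. Here complexity is data complexity: $k$, $\varphi$ and $\varphi'$ are fixed. -/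

import Mathlib

namespace HQ

/-! ### Boolean functions and the Euler characteristic -/

/-- A Boolean function on `V`: it maps each valuation (a subset of `V`) to a truth value. -/
abbrev BoolFun (V : Type) := Finset V → Bool

/-- The Euler characteristic: the sum of `(-1) ^ |ν|` over the satisfying valuations `ν`. -/
def eul {V : Type} [Fintype V] [DecidableEq V] (φ : BoolFun V) : ℤ :=
  ∑ ν : Finset V with φ ν = true, (-1) ^ ν.card

/-! ### Databases, Boolean queries and the queries `Q_φ` -/

/-- Facts over the signature `R, S₁, …, S_k, T`, with constants in `ℕ`.
The predicate `S_{j+1}` is written `S j`, for `j = 0, …, k - 1`. -/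
inductive Fact (k : ℕ) where
  | R (a : ℕ)
  | S (j : Fin k) (a b : ℕ)
  | T (a : ℕ)
  deriving DecidableEq

/-- A relational instance: a finite set of facts. -/
abbrev Database (k : ℕ) := Finset (Fact k)

/-- A Boolean query: the property of databases that it expresses. -/
abbrev BoolQuery (k : ℕ) := Database k → Prop

/-- First atom of `h_{k,i}`: `R(x)` if `i = 0`, and `S_i(x,y)` if `1 ≤ i ≤ k`. -/
def firstAtom {k : ℕ} (i : Fin (k + 1)) (x y : ℕ) : Fact k :=
  Fin.cases (Fact.R x) (fun j => Fact.S j x y) i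

/-- Second atom of `h_{k,i}`: `S_{i+1}(x,y)` if `0 ≤ i < k`, and `T(y)` if `i = k`. -/
def secondAtom {k : ℕ} (i : Fin (k + 1)) (x y : ℕ) : Fact k :=
  Fin.lastCases (Fact.T y) (fun j => Fact.S j x y) i

/-- The conjunctive query `h_{k,i}`. -/
def hk {k : ℕ} (i : Fin (k + 1)) : BoolQuery k :=
  fun D => ∃ x y : ℕ, firstAtom i x y ∈ D ∧ secondAtom i x y ∈ D

open Classical in
/-- The query `Q_φ`, that is, `φ` with each variable `i` replaced by `h_{k,i}`. -/
def hQuery {k : ℕ} (φ : BoolFun (Fin (k + 1))) : BoolQuery k :=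
  fun D => φ {i | hk i D} = true

/-! ### Tuple-independent databases -/

/-- A tuple-independent database `(D, π)`; the values of `π` outside `D` play no role. -/
structure TID (k : ℕ) where
  D : Database k
  π : Fact k → ℚ
  nonneg : ∀ t ∈ D, 0 ≤ π t
  le_one : ∀ t ∈ D, π t ≤ 1

/-- The probability of the sub-database `D'` of `I.D`. -/
def TID.worldProb {k : ℕ} (I : TID k) (D' : Database k) : ℚ :=
  (∏ t ∈ D', I.π t) * ∏ t ∈ I.D \ D', (1 - I.π t)

open Classical in
/-- The probability that `Q` is satisfied. -/
noncomputable def TID.prob {k : ℕ} (I : TID k) (Q : BoolQuery k) : ℚ :=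
  ∑ D' ∈ I.D.powerset with Q D', I.worldProb D'

/-! ### Boolean circuits and d-Ds -/

/-- Gates of a circuit with variables in `α`; inputs are designated by gate numbers. Fan-in is
unbounded; `and []` and `or []` are the constants. -/
inductive Gate (α : Type) where
  | var (t : α)
  | not (j : ℕ)
  | and (js : List ℕ)
  | or (js : List ℕ)

/-- The input gates of a gate. -/
def Gate.inputs {α : Type} : Gate α → List ℕ
  | .var _ => []
  | .not j => [j]
  | .and js => js
  | .or js => js

/-- A circuit: its gates, listed in a topological order and numbered from `0`, and the number of
its output gate. -/
structure Circuit (α : Type) where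
  gates : List (Gate α)
  out : ℕ

namespace Circuit

variable {α : Type}

/-- The output gate exists, and every wire goes from a gate to a later one. -/
def WellFormed (C : Circuit α) : Prop :=
  C.out < C.gates.length ∧ ∀ (i : ℕ) (g : Gate α), C.gates[i]? = some g → ∀ j ∈ g.inputs, j < i

/-- Number of gates plus number of wires. -/
def size (C : Circuit α) : ℕ :=
  (C.gates.map fun g => 1 + g.inputs.length).sum

/-- The value of gate `i` under the valuation `ν`. (In a well-formed circuit the tests `j < i`
always succeed.) -/
def eval [DecidableEq α] (C : Circuit α) (ν : Finset α) (i : ℕ) : Bool :=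
  match C.gates[i]? with
  | none => false
  | some (.var t) => decide (t ∈ ν)
  | some (.not j) => if _h : j < i then !(eval C ν j) else false
  | some (.and js) => js.all fun j => if _h : j < i then eval C ν j else false
  | some (.or js) => js.any fun j => if _h : j < i then eval C ν j else false
termination_by i

/-- `C.HasVar i t`: a variable gate labelled `t` has a directed path to gate `i`. -/
inductive HasVar (C : Circuit α) : ℕ → α → Prop
  | var {i : ℕ} {t : α} : C.gates[i]? = some (.var t) → HasVar C i t
  | wire {i j : ℕ} {g : Gate α} {t : α} :
      C.gates[i]? = some g → j ∈ g.inputs → HasVar C j t → HasVar C i t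

/-- Distinct inputs of an `∧`-gate depend on disjoint sets of variables. -/
def Decomposable (C : Circuit α) : Prop :=
  ∀ (i : ℕ) (js : List ℕ), C.gates[i]? = some (.and js) → ∀ j₁ ∈ js, ∀ j₂ ∈ js, j₁ ≠ j₂ →
    ∀ t, ¬ (C.HasVar j₁ t ∧ C.HasVar j₂ t)

/-- Distinct inputs of an `∨`-gate capture disjoint Boolean functions. -/
def Deterministic [DecidableEq α] (C : Circuit α) : Prop :=
  ∀ (i : ℕ) (js : List ℕ), C.gates[i]? = some (.or js) → ∀ j₁ ∈ js, ∀ j₂ ∈ js, j₁ ≠ j₂ →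
    ∀ ν : Finset α, ¬ (C.eval ν j₁ = true ∧ C.eval ν j₂ = true)

/-- Deterministic decomposable circuits. -/
def IsDD [DecidableEq α] (C : Circuit α) : Prop :=
  C.WellFormed ∧ C.Decomposable ∧ C.Deterministic

/-- `C` is a circuit over the facts of `D` which captures the lineage of `Q` on `D`, the Boolean
function that maps `D' ⊆ D` to true if and only if `D'` satisfies `Q`. -/
def RepresentsLineage {k : ℕ} (C : Circuit (Fact k)) (Q : BoolQuery k) (D : Database k) : Prop :=
  (∀ t, Gate.var t ∈ C.gates → t ∈ D) ∧ ∀ D' ⊆ D, (C.eval D' C.out = true ↔ Q D')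

end Circuit

/-! ### Programs with an oracle, and their running time

Programs manipulate finite binary trees whose leaves are natural numbers written in binary.
Every executed operation is charged the number of bits and nodes of its input and of its output
(logarithmic cost), so that running times agree with those of (oracle) Turing machines up to a
polynomial. -/

inductive Val where
  | nat (n : ℕ)
  | pair (a b : Val)
  deriving DecidableEq

namespace Val

/-- Length of a value: number of nodes, plus the lengths of the binary expansions at the leaves. -/
def size : Val → ℕ
  | nat n => Nat.size n + 1
  | pair a b => a.size + b.size + 1

def fst : Val → Val
  | nat _ => nat 0
  | pair a _ => a

def snd : Val → Val
  | nat _ => nat 0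
  | pair _ b => b

/-- A binary operation on numbers, applied to a pair of leaves (and `0` on other values). -/
def arith (f : ℕ → ℕ → ℕ) : Val → Val
  | pair (nat a) (nat b) => nat (f a b)
  | _ => nat 0

/-- Equality test for the two components of a pair. -/
def eqTest (x : Val) : Val := if x.fst = x.snd then nat 1 else nat 0

end Val

/-- Basic operations, each performed by one instruction. -/
inductive Op where
  | id
  | const (v : Val)
  | fst
  | snd
  | add
  | sub
  | mul
  | div
  | eq

def Op.apply : Op → Val → Val
  | .id, x => x
  | .const v, _ => v
  | .fst, x => x.fst
  | .snd, x => x.snd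
  | .add, x => x.arith (· + ·)
  | .sub, x => x.arith (· - ·)
  | .mul, x => x.arith (· * ·)
  | .div, x => x.arith (· / ·)
  | .eq, x => x.eqTest

/-- Programs transforming a value:
a basic operation; a call of the oracle on the current value; `pair p q`, which runs `p` and `q` on
the current value and pairs the results; `seq p q`, which runs `p` and then `q`; `ite c p q`, which
runs `p` if the result of `c` is not the leaf `0` and `q` otherwise; `loop p`, which repeats `p` as
long as the first component of the current value is not the leaf `0`. -/
inductive Prog where
  | op (o : Op)
  | oracle
  | pair (p q : Prog)
  | seq (p q : Prog)
  | ite (c p q : Prog)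
  | loop (p : Prog)

/-- `Runs O p x y t`: with oracle `O`, the program `p` started on `x` halts with result `y`, at
cost `t`. -/
inductive Runs (O : Val → Val) : Prog → Val → Val → ℕ → Prop
  | op (o : Op) (x : Val) : Runs O (.op o) x (o.apply x) (x.size + (o.apply x).size)
  | oracle (x : Val) : Runs O .oracle x (O x) (x.size + (O x).size)
  | pair {p q : Prog} {x y z : Val} {s t : ℕ} :
      Runs O p x y s → Runs O q x z t →
      Runs O (.pair p q) x (.pair y z) (s + t + x.size + (Val.pair y z).size)
  | seq {p q : Prog} {x y z : Val} {s t : ℕ} :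
      Runs O p x y s → Runs O q y z t → Runs O (.seq p q) x z (s + t + x.size + z.size)
  | ite_true {c p q : Prog} {x b y : Val} {s t : ℕ} :
      Runs O c x b s → b ≠ .nat 0 → Runs O p x y t →
      Runs O (.ite c p q) x y (s + t + x.size + y.size)
  | ite_false {c p q : Prog} {x y : Val} {s t : ℕ} :
      Runs O c x (.nat 0) s → Runs O q x y t →
      Runs O (.ite c p q) x y (s + t + x.size + y.size)
  | loop_done {p : Prog} {x : Val} :
      x.fst = .nat 0 → Runs O (.loop p) x x (x.size + x.size)
  | loop_step {p : Prog} {x y z : Val} {s t : ℕ} :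
      x.fst ≠ .nat 0 → Runs O p x y s → Runs O (.loop p) y z t →
      Runs O (.loop p) x z (s + t + x.size + z.size)

/-- A program without access to an oracle: the oracle always answers `0`. -/
def noOracle : Val → Val := fun _ => .nat 0

/-- A computational problem that asks for a value, given by its graph: `P x y` says that `x` is an
instance and that `y` is the answer to it. -/
abbrev Problem := Val → Val → Prop

/-- Polynomial-time Turing reducibility `P ≤_T P'`: some program solves `P` in polynomial time when
given any oracle that answers the instances of `P'` correctly. -/
def TuringReducible (P P' : Problem) : Prop :=
  ∃ (p : Prog) (b : Polynomial ℕ), ∀ O : Val → Val, (∀ x y, P' x y → O x = y) →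
    ∀ x y, P x y → ∃ t ≤ b.eval x.size, Runs O p x y t

/-- Polynomial-time Turing equivalence `P ≡_T P'`. -/
def TuringEquivalent (P P' : Problem) : Prop :=
  TuringReducible P P' ∧ TuringReducible P' P

/-! ### Encodings -/

def encList : List Val → Val
  | [] => .nat 0
  | v :: l => .pair v (encList l)

def encFact {k : ℕ} : Fact k → Val
  | .R a => .pair (.nat 0) (.nat a)
  | .S j a b => .pair (.nat 1) (.pair (.nat j) (.pair (.nat a) (.nat b)))
  | .T a => .pair (.nat 2) (.nat a)

/-- An integer `z` is coded by the pair of its positive and negative parts. -/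
def encInt (z : ℤ) : Val := .pair (.nat z.toNat) (.nat (-z).toNat)

/-- A rational number is coded by its numerator and denominator, in lowest terms. -/
def encRat (q : ℚ) : Val := .pair (encInt q.num) (.nat q.den)

/-- The list `l` enumerates the facts of `D` without repetition. -/
def Lists {k : ℕ} (l : List (Fact k)) (D : Database k) : Prop :=
  l.Nodup ∧ l.toFinset = D

def encFacts {k : ℕ} (l : List (Fact k)) : Val := encList (l.map encFact)

/-- Facts together with their probabilities. -/
def encTID {k : ℕ} (l : List (Fact k)) (π : Fact k → ℚ) : Val :=
  encList (l.map fun t => .pair (encFact t) (encRat (π t)))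

def encGate {k : ℕ} : Gate (Fact k) → Val
  | .var t => .pair (.nat 0) (encFact t)
  | .not j => .pair (.nat 1) (.nat j)
  | .and js => .pair (.nat 2) (encList (js.map .nat))
  | .or js => .pair (.nat 3) (encList (js.map .nat))

def encCircuit {k : ℕ} (C : Circuit (Fact k)) : Val :=
  .pair (encList (C.gates.map encGate)) (.nat C.out)

/-! ### The problem `PQE(Q)` and the classes `d-D(PTIME)` and `d-D(PSIZE)` -/

/-- Probabilistic query evaluation for `Q`: given a tuple-independent database, its facts being
listed in any order, compute the probability that `Q` is satisfied. -/
def PQE {k : ℕ} (Q : BoolQuery k) : Problem :=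
  fun x y => ∃ (I : TID k) (l : List (Fact k)),
    Lists l I.D ∧ x = encTID l I.π ∧ y = encRat (I.prob Q)

/-- `Q ∈ d-D(PTIME)`: given a database, its facts being listed in any order, a d-D that represents
the lineage of `Q` can be computed in polynomial time. -/
def DDPtime {k : ℕ} (Q : BoolQuery k) : Prop :=
  ∃ (p : Prog) (b : Polynomial ℕ), ∀ (D : Database k) (l : List (Fact k)), Lists l D →
    ∃ C : Circuit (Fact k), C.IsDD ∧ C.RepresentsLineage Q D ∧
      ∃ t ≤ b.eval (encFacts l).size, Runs noOracle p (encFacts l) (encCircuit C) t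

/-- `Q ∈ d-D(PSIZE)`: the lineage of `Q` on any database has a d-D of size polynomial in the number
of facts. -/
def DDPsize {k : ℕ} (Q : BoolQuery k) : Prop :=
  ∃ b : Polynomial ℕ, ∀ D : Database k,
    ∃ C : Circuit (Fact k), C.IsDD ∧ C.RepresentsLineage Q D ∧ C.size ≤ b.eval D.card

end HQ

/-!
Negating the values of `φ` at the sets of odd cardinality turns `eul φ`, up to a constant, into
the number of sets where the function is true. Hence two functions with the same Euler
characteristic differ, after this twist, by a permutation of the subsets of `V`, and such a
permutation is a product of swaps of adjacent sets `ν` and `ν ∪ {i}`. Undoing the twist, a swap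
either has no effect or adds or removes both sets of the pair, and a removal is an addition to the
negated function. So `φ'` is obtained from `φ` by negations and by disjunctions with functions
that are true exactly on `ν` and `ν ∪ {i}` and disjoint from what they are added to, two
operations that d-Ds and probabilities follow.

The query of such a pair does not depend on `h_{k,i}`, so it falls apart into conditions on the
chain `R, S_1, …, S_i`, whose matches share their first component, and on the chain `S_{i+1}, …,
S_k, T`, whose matches share their second component. When the facts are read chain by chain, an
automaton of constant size decides the query; it yields a d-D of polynomial size as well as the
probability.
-/

namespace HQ

/-! ### Polynomial-time functions between encoded types -/

/-- A type whose elements are coded by values. -/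
class Enc (A : Type) where
  enc : A → Val

open Enc

instance : Enc ℕ := ⟨.nat⟩

instance : Enc Bool := ⟨fun b => .nat b.toNat⟩

instance {A B : Type} [Enc A] [Enc B] : Enc (A × B) := ⟨fun x => .pair (enc x.1) (enc x.2)⟩

instance {A : Type} [Enc A] : Enc (List A) := ⟨fun l => encList (l.map enc)⟩

theorem enc_nat_injective : Function.Injective (enc : ℕ → Val) := fun _ _ => Val.nat.inj

section Sizes

variable {A B : Type} [Enc A] [Enc B]

/-- The length of the code of `a`. -/
def sz (a : A) : ℕ := (enc a).size

theorem Val.one_le_size (v : Val) : 1 ≤ v.size := by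
  cases v <;> simp [Val.size]

theorem one_le_sz (a : A) : 1 ≤ sz a := Val.one_le_size _

theorem sz_nat (n : ℕ) : sz n = Nat.size n + 1 := rfl

theorem sz_bool_le (b : Bool) : sz b ≤ 2 := by
  cases b <;> simp [sz, enc, Val.size]

theorem sz_prod (x : A × B) : sz x = sz x.1 + sz x.2 + 1 := rfl

theorem sz_nil : sz ([] : List A) = 1 := by simp [sz, enc, encList, Val.size]

theorem sz_cons (a : A) (l : List A) : sz (a :: l) = sz a + sz l + 1 := rfl

theorem sz_append (l l' : List A) : sz (l ++ l') + 1 = sz l + sz l' := by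
  induction l with
  | nil => rw [List.nil_append, sz_nil, Nat.add_comm]
  | cons a l ih => simp only [List.cons_append, sz_cons]; omega

theorem length_lt_sz (l : List A) : l.length < sz l := by
  induction l with
  | nil => simp [sz_nil]
  | cons a l ih => simp only [List.length_cons, sz_cons]; omega

theorem sz_le_of_mem {a : A} {l : List A} (h : a ∈ l) : sz a ≤ sz l := by
  induction l with
  | nil => simp at h
  | cons b l ih =>
    rw [sz_cons]
    rcases List.mem_cons.1 h with rfl | h
    · omega
    · have := ih h; omega

theorem sz_list_le {l : List A} {c : ℕ} (h : ∀ a ∈ l, sz a ≤ c) :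
    sz l ≤ l.length * (c + 1) + 1 := by
  induction l with
  | nil => simp [sz_nil]
  | cons a l ih =>
    have hl := ih fun a ha => h a (by simp [ha])
    have ha := h a (by simp)
    rw [sz_cons, List.length_cons, add_mul]
    omega

theorem size_mul_le (m n : ℕ) : Nat.size (m * n) ≤ Nat.size m + Nat.size n := by
  rw [Nat.size_le, pow_add]
  exact Nat.mul_lt_mul'' (Nat.lt_size_self m) (Nat.lt_size_self n)

theorem size_add_le (m n : ℕ) : Nat.size (m + n) ≤ Nat.size m + Nat.size n + 1 := by
  rw [Nat.size_le, pow_succ, pow_add]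
  have hm := Nat.lt_size_self m
  have hn := Nat.lt_size_self n
  nlinarith [Nat.one_le_two_pow (n := Nat.size m), Nat.one_le_two_pow (n := Nat.size n)]

end Sizes

section PolyBounded

variable {A B : Type} [Enc A] [Enc B] {u v : A → ℕ}

theorem polynomial_eval_mono (b : Polynomial ℕ) : Monotone fun n => b.eval n := by
  intro m n h
  simp only [Polynomial.eval_eq_sum]
  exact Finset.sum_le_sum fun i _ => Nat.mul_le_mul_left _ (Nat.pow_le_pow_left h i)

/-- The number `u a` is bounded by a polynomial in the length of the code of `a`. -/
@[fun_prop]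
def PolyBounded (u : A → ℕ) : Prop :=
  ∃ b : Polynomial ℕ, ∀ a, u a ≤ b.eval (sz a)

namespace PolyBounded

theorem of_le (hv : PolyBounded v) (h : ∀ a, u a ≤ v a) : PolyBounded u :=
  hv.imp fun _ hb a => (h a).trans (hb a)

@[fun_prop]
theorem sz_self : PolyBounded (sz : A → ℕ) := ⟨.X, fun a => by simp⟩

@[fun_prop]
theorem const (n : ℕ) : PolyBounded fun _ : A => n := ⟨.C n, fun a => by simp⟩

@[fun_prop]
theorem add (hu : PolyBounded u) (hv : PolyBounded v) : PolyBounded fun a => u a + v a := by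
  obtain ⟨b, hb⟩ := hu
  obtain ⟨c, hc⟩ := hv
  exact ⟨b + c, fun a => by simpa using Nat.add_le_add (hb a) (hc a)⟩

@[fun_prop]
theorem mul (hu : PolyBounded u) (hv : PolyBounded v) : PolyBounded fun a => u a * v a := by
  obtain ⟨b, hb⟩ := hu
  obtain ⟨c, hc⟩ := hv
  exact ⟨b * c, fun a => by simpa using Nat.mul_le_mul (hb a) (hc a)⟩

@[fun_prop]
theorem eval (c : Polynomial ℕ) (hu : PolyBounded u) : PolyBounded fun a => c.eval (u a) := by
  obtain ⟨b, hb⟩ := hu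
  exact ⟨c.comp b, fun a => by simpa using polynomial_eval_mono c (hb a)⟩

theorem comp {w : B → ℕ} {f : A → B} (hw : PolyBounded w) (hf : PolyBounded fun a => sz (f a)) :
    PolyBounded fun a => w (f a) := by
  obtain ⟨c, hc⟩ := hw
  exact (hf.eval c).of_le fun a => hc (f a)

end PolyBounded

end PolyBounded

theorem Runs.size_le {O : Val → Val} {p : Prog} {x y : Val} {t : ℕ} (h : Runs O p x y t) :
    x.size ≤ t ∧ y.size ≤ t := by
  cases h <;> constructor <;> omega

theorem exists_runs_loop {S : Type} [Enc S] {O : Val → Val} {p : Prog} {I : S → Prop} {μ : S → ℕ}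
    {c : ℕ} {r : S}
    (h : ∀ s, I s → (enc s).fst = .nat 0 ∧ s = r ∨ (enc s).fst ≠ .nat 0 ∧
      ∃ s', I s' ∧ μ s' < μ s ∧ ∃ t ≤ c, Runs O p (enc s) (enc s') t) (s : S) (hs : I s) :
    ∃ t ≤ μ s * (2 * c + sz r) + 2 * sz r, Runs O (.loop p) (enc s) (enc r) t := by
  induction hn : μ s using Nat.strong_induction_on generalizing s with
  | h n ih =>
    subst hn
    rcases h s hs with ⟨hzero, rfl⟩ | ⟨hgo, s', hs', hμ, t, ht, hr⟩
    · exact ⟨_, by rw [two_mul (sz s)]; exact Nat.le_add_left _ _, Runs.loop_done hzero⟩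
    · obtain ⟨t', ht', hr'⟩ := ih _ hμ s' hs' rfl
      refine ⟨_, ?_, Runs.loop_step hgo hr hr'⟩
      have hsize := hr.size_le.1
      have hmul := Nat.mul_le_mul_right (2 * c + sz r) (Nat.succ_le_of_lt hμ)
      rw [Nat.succ_mul] at hmul
      unfold sz at *
      omega

section PolyTime

variable {X A B C : Type} [Enc X] [Enc A] [Enc B] [Enc C] {Os : Set (Val → Val)}

/-- Some program computes `f` in polynomial time, whichever oracle of the set `Os` it is given.
The first condition follows from the second one unless `Os` is empty. -/
@[fun_prop]
def PolyTime (Os : Set (Val → Val)) (f : A → B) : Prop :=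
  (PolyBounded fun a => sz (f a)) ∧ ∃ (p : Prog) (c : A → ℕ), PolyBounded c ∧
    ∀ O ∈ Os, ∀ a, ∃ t ≤ c a, Runs O p (enc a) (enc (f a)) t

namespace PolyTime

@[fun_prop]
theorem polyBounded_sz {f : A → B} (hf : PolyTime Os f) : PolyBounded fun a => sz (f a) := hf.1

theorem of_runs (p : Prog) {f : A → B} {c : A → ℕ} (hs : PolyBounded fun a => sz (f a))
    (hc : PolyBounded c) (h : ∀ O ∈ Os, ∀ a, ∃ t ≤ c a, Runs O p (enc a) (enc (f a)) t) :
    PolyTime Os f :=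
  ⟨hs, p, c, hc, h⟩

theorem of_polynomial {O : Val → Val} (hO : O ∈ Os) (p : Prog) (b : Polynomial ℕ) {f : A → B}
    (h : ∀ O ∈ Os, ∀ a, ∃ t ≤ b.eval (sz a), Runs O p (enc a) (enc (f a)) t) : PolyTime Os f := by
  refine of_runs p ⟨b, fun a => ?_⟩ ⟨b, fun a => le_rfl⟩ h
  obtain ⟨t, ht, hr⟩ := h O hO a
  exact hr.size_le.2.trans ht

theorem exists_polynomial {f : A → B} (hf : PolyTime Os f) : ∃ (p : Prog) (b : Polynomial ℕ),
    ∀ O ∈ Os, ∀ a, ∃ t ≤ b.eval (sz a), Runs O p (enc a) (enc (f a)) t := by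
  obtain ⟨-, p, c, ⟨b, hb⟩, hp⟩ := hf
  refine ⟨p, b, fun O hO a => ?_⟩
  obtain ⟨t, ht, hr⟩ := hp O hO a
  exact ⟨t, ht.trans (hb a), hr⟩

theorem of_op (o : Op) {f : A → B} (h : ∀ a, o.apply (enc a) = enc (f a))
    (hs : PolyBounded fun a => sz (f a)) : PolyTime Os f :=
  of_runs (.op o) hs (c := fun a => sz a + sz (f a)) (by fun_prop) fun _ _ a =>
    ⟨_, (congrArg (sz a + Val.size ·) (h a)).le, h a ▸ Runs.op o (enc a)⟩

theorem of_enc_eq {f : A → B} (h : ∀ a, enc (f a) = enc a) : PolyTime Os f :=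
  .of_op .id (fun a => (h a).symm) (PolyBounded.sz_self.of_le fun a => by rw [sz, h, sz])

theorem congr_enc {f : A → B} {g : A → C} (hf : PolyTime Os f) (h : ∀ a, enc (g a) = enc (f a)) :
    PolyTime Os g := by
  obtain ⟨hs, p, c, hc, hp⟩ := hf
  simp only [sz, ← h] at hs hp
  exact ⟨hs, p, c, hc, hp⟩

theorem congr {f g : A → B} (hf : PolyTime Os f) (h : ∀ a, g a = f a) : PolyTime Os g :=
  hf.congr_enc fun a => congrArg enc (h a)

@[fun_prop]
theorem id : PolyTime Os fun a : A => a := .of_enc_eq fun _ => rfl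

@[fun_prop]
theorem const (c : B) : PolyTime Os fun _ : A => c :=
  .of_op (.const (enc c)) (fun _ => rfl) (.const (sz c))

@[fun_prop]
theorem comp {g : B → C} {f : A → B} (hg : PolyTime Os g) (hf : PolyTime Os f) :
    PolyTime Os fun a => g (f a) := by
  obtain ⟨hsf, p, c, hc, hp⟩ := hf
  obtain ⟨hsg, q, d, hd, hq⟩ := hg
  have hdf := hd.comp hsf
  have hsgf := hsg.comp hsf
  refine of_runs (.seq p q) hsgf (((hc.add hdf).add .sz_self).add hsgf) fun O hO a => ?_
  obtain ⟨s, hs, hrs⟩ := hp O hO a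
  obtain ⟨t, ht, hrt⟩ := hq O hO (f a)
  exact ⟨_, by gcongr <;> rfl, Runs.seq hrs hrt⟩

@[fun_prop]
theorem pair {f : A → B} {g : A → C} (hf : PolyTime Os f) (hg : PolyTime Os g) :
    PolyTime Os fun a => (f a, g a) := by
  obtain ⟨hsf, p, c, hc, hp⟩ := hf
  obtain ⟨hsg, q, d, hd, hq⟩ := hg
  have hs : PolyBounded fun a => sz (f a, g a) := (hsf.add hsg).add (.const 1)
  refine of_runs (.pair p q) hs (((hc.add hd).add .sz_self).add hs) fun O hO a => ?_
  obtain ⟨s, hs, hrs⟩ := hp O hO a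
  obtain ⟨t, ht, hrt⟩ := hq O hO a
  exact ⟨_, by gcongr <;> rfl, Runs.pair hrs hrt⟩

theorem prodFst : PolyTime Os (Prod.fst : A × B → A) :=
  .of_op .fst (fun _ => rfl) (PolyBounded.sz_self.of_le fun a => by rw [sz_prod a]; omega)

theorem prodSnd : PolyTime Os (Prod.snd : A × B → B) :=
  .of_op .snd (fun _ => rfl) (PolyBounded.sz_self.of_le fun a => by rw [sz_prod a]; omega)

@[fun_prop]
theorem fst {f : A → B × C} (hf : PolyTime Os f) : PolyTime Os fun a => (f a).1 :=
  prodFst.comp hf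

@[fun_prop]
theorem snd {f : A → B × C} (hf : PolyTime Os f) : PolyTime Os fun a => (f a).2 :=
  prodSnd.comp hf

@[fun_prop]
theorem cond {c : A → Bool} {f g : A → B} (hc : PolyTime Os c) (hf : PolyTime Os f)
    (hg : PolyTime Os g) : PolyTime Os fun a => bif c a then f a else g a := by
  obtain ⟨-, r, d, hd, hr⟩ := hc
  obtain ⟨hsf, p, b, hb, hp⟩ := hf
  obtain ⟨hsg, q, e, he, hq⟩ := hg
  have hs : PolyBounded fun a => sz (bif c a then f a else g a) :=
    (hsf.add hsg).of_le fun a => by cases c a <;> simp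
  refine of_runs (.ite r p q) hs (((hd.add (hb.add he)).add .sz_self).add hs) fun O hO a => ?_
  obtain ⟨u, hu, hru⟩ := hr O hO a
  obtain ⟨s, hs, hrs⟩ := hp O hO a
  obtain ⟨t, ht, hrt⟩ := hq O hO a
  cases h : c a <;> rw [h] at hru
  · exact ⟨_, by gcongr <;> first | rfl | omega, Runs.ite_false hru hrt⟩
  · exact ⟨_, by gcongr <;> first | rfl | omega, Runs.ite_true hru (by simp [enc]) hrs⟩

@[fun_prop]
theorem not {c : A → Bool} (hc : PolyTime Os c) : PolyTime Os fun a => !c a :=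
  (hc.cond (const false) (const true)).congr fun a => by cases c a <;> rfl

@[fun_prop]
theorem and {c d : A → Bool} (hc : PolyTime Os c) (hd : PolyTime Os d) :
    PolyTime Os fun a => c a && d a :=
  (hc.cond hd (const false)).congr fun a => by cases c a <;> rfl

@[fun_prop]
theorem or {c d : A → Bool} (hc : PolyTime Os c) (hd : PolyTime Os d) :
    PolyTime Os fun a => c a || d a :=
  (hc.cond (const true) hd).congr fun a => by cases c a <;> rfl

theorem decide_eq (hB : Function.Injective (enc : B → Val)) [DecidableEq B] {f g : A → B}
    (hf : PolyTime Os f) (hg : PolyTime Os g) : PolyTime Os fun a => decide (f a = g a) := by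
  refine comp (g := fun x : B × B => decide (x.1 = x.2)) (.of_op .eq (fun x => ?_) ?_) (hf.pair hg)
  · change (if enc x.1 = enc x.2 then Val.nat 1 else .nat 0) = Val.nat (decide (x.1 = x.2)).toNat
    by_cases h : x.1 = x.2 <;> simp [h, hB.eq_iff]
  · exact (PolyBounded.const 2).of_le fun x => sz_bool_le _

@[fun_prop]
theorem decide_nat_eq {f g : A → ℕ} (hf : PolyTime Os f) (hg : PolyTime Os g) :
    PolyTime Os fun a => decide (f a = g a) := decide_eq enc_nat_injective hf hg

theorem arith (o : Op) (F : ℕ → ℕ → ℕ) (ho : ∀ x, o.apply x = x.arith F)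
    (hF : ∀ m n, Nat.size (F m n) ≤ Nat.size m + Nat.size n + 1) {f g : A → ℕ}
    (hf : PolyTime Os f) (hg : PolyTime Os g) : PolyTime Os fun a => F (f a) (g a) := by
  refine comp (g := fun x : ℕ × ℕ => F x.1 x.2) (.of_op o (fun x => by rw [ho]; rfl) ?_)
    (hf.pair hg)
  refine PolyBounded.sz_self.of_le fun x => ?_
  have := hF x.1 x.2
  rw [sz_prod x, sz_nat, sz_nat, sz_nat]
  omega

@[fun_prop]
theorem add {f g : A → ℕ} (hf : PolyTime Os f) (hg : PolyTime Os g) :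
    PolyTime Os fun a => f a + g a :=
  .arith .add (· + ·) (fun _ => rfl) size_add_le hf hg

@[fun_prop]
theorem mul {f g : A → ℕ} (hf : PolyTime Os f) (hg : PolyTime Os g) :
    PolyTime Os fun a => f a * g a :=
  .arith .mul (· * ·) (fun _ => rfl) (fun m n => (size_mul_le m n).trans (by omega)) hf hg

@[fun_prop]
theorem sub {f g : A → ℕ} (hf : PolyTime Os f) (hg : PolyTime Os g) :
    PolyTime Os fun a => f a - g a :=
  .arith .sub (· - ·) (fun _ => rfl)
    (fun m n => (Nat.size_le_size (Nat.sub_le m n)).trans (by omega)) hf hg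

@[fun_prop]
theorem div {f g : A → ℕ} (hf : PolyTime Os f) (hg : PolyTime Os g) :
    PolyTime Os fun a => f a / g a :=
  .arith .div (· / ·) (fun _ => rfl)
    (fun m n => (Nat.size_le_size (Nat.div_le_self m n)).trans (by omega)) hf hg

@[fun_prop]
theorem mod {f g : A → ℕ} (hf : PolyTime Os f) (hg : PolyTime Os g) :
    PolyTime Os fun a => f a % g a :=
  (hf.sub (hg.mul (hf.div hg))).congr fun _ => Nat.mod_eq_sub _ _

/-- Elements of `P` are the states on which the loop does not stop yet: they have the same codes as
states of type `S`, but the body of the loop may decompose them further. -/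
theorem loop {S P : Type} [Enc S] [Enc P] {step : P → S} {start result : X → S}
    {I : X → S → Prop} {μ : S → ℕ} {bound : X → ℕ} (hstep : PolyTime Os step)
    (hstart : PolyTime Os start) (hI : ∀ x, I x (start x))
    (h : ∀ x s, I x s → (enc s).fst = .nat 0 ∧ s = result x ∨ (enc s).fst ≠ .nat 0 ∧
      ∃ q : P, enc q = enc s ∧ I x (step q) ∧ μ (step q) < μ s)
    (hbound : PolyBounded bound) (hsz : ∀ x s, I x s → sz s ≤ bound x)
    (hμ : ∀ s, μ s ≤ sz s) (hresult : ∀ x, I x (result x)) :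
    PolyTime Os result := by
  obtain ⟨-, p, c, ⟨b, hb⟩, hp⟩ := hstep
  obtain ⟨-, p₀, c₀, hc₀, hp₀⟩ := hstart
  have hsr : ∀ x, sz (result x) ≤ bound x := fun x => hsz x _ (hresult x)
  refine of_runs (.seq p₀ (.loop p)) (hbound.of_le hsr)
    (c := fun x => c₀ x + (bound x * (2 * b.eval (bound x) + bound x) + 2 * bound x) + sz x +
      bound x) (by fun_prop) fun O hO x => ?_
  obtain ⟨t₀, ht₀, hr₀⟩ := hp₀ O hO x
  obtain ⟨t, ht, hr⟩ := exists_runs_loop (O := O) (p := p) (μ := μ) (c := b.eval (bound x))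
    (fun s hs => (h x s hs).imp_right fun ⟨hgo, q, hq, hIq, hμq⟩ => by
      obtain ⟨t, ht, hr⟩ := hp O hO q
      have hsq : sz q ≤ bound x := (congrArg Val.size hq).trans_le (hsz x s hs)
      exact ⟨hgo, step q, hIq, hμq, t,
        ht.trans ((hb q).trans (polynomial_eval_mono b hsq)), hq ▸ hr⟩) (start x) (hI x)
  have hμ₀ : μ (start x) ≤ bound x := (hμ _).trans (hsz x _ (hI x))
  have ht' : t ≤ bound x * (2 * b.eval (bound x) + bound x) + 2 * bound x :=
    ht.trans (by have := hsr x; gcongr)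
  exact ⟨_, by gcongr; exacts [le_rfl, hsr x], Runs.seq hr₀ hr⟩

theorem foldl {S : Type} [Enc S] {l : X → List A} {s : X → S} {step : X → S → A → S}
    {bound : X → ℕ} (hl : PolyTime Os l) (hs : PolyTime Os s)
    (hstep : PolyTime Os fun q : X × S × A => step q.1 q.2.1 q.2.2) (hbound : PolyBounded bound)
    (hle : ∀ x l', l' <+: l x → sz (l'.foldl (step x) (s x)) ≤ bound x) :
    PolyTime Os fun x => (l x).foldl (step x) (s x) := by
  have hbody : PolyTime Os fun q : (A × List A) × X × S =>
      (q.1.2, q.2.1, step q.2.1 q.2.2 q.1.1) :=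
    id.fst.snd.pair (id.snd.fst.pair
      (hstep.comp (id.snd.fst.pair (id.snd.snd.pair id.fst.fst))))
  have hstart : PolyTime Os fun x => (l x, x, s x) := hl.pair (id.pair hs)
  have := hl.polyBounded_sz
  refine (loop (result := fun x => (([] : List A), x, (l x).foldl (step x) (s x)))
    (I := fun x q => q.2.1 = x ∧ ∃ l', l' ++ q.1 = l x ∧ l'.foldl (step x) (s x) = q.2.2)
    (μ := fun q => q.1.length) (bound := fun x => sz (l x) + (sz x + bound x + 1) + 1)
    hbody hstart (fun x => ⟨rfl, [], rfl, rfl⟩) ?_ (by fun_prop) ?_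
    (fun q => (length_lt_sz q.1).le.trans (by rw [sz_prod q]; omega))
    (fun x => ⟨rfl, l x, List.append_nil _, rfl⟩)).snd.snd
  · rintro x ⟨_ | ⟨a, l₂⟩, x', r⟩ ⟨hx, l₁, hl₁, hr⟩ <;> obtain rfl : x' = x := hx <;>
      obtain rfl : _ = r := hr
    · rw [List.append_nil] at hl₁
      exact .inl ⟨rfl, by rw [hl₁]⟩
    · exact .inr ⟨nofun, ((a, l₂), _, _), rfl, ⟨rfl, l₁ ++ [a], by simp [← hl₁],
        List.foldl_append⟩, Nat.lt_succ_self _⟩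
  · rintro x ⟨l₂, x', r⟩ ⟨hx, l₁, hl₁, hr⟩
    obtain rfl : x' = x := hx
    obtain rfl : _ = r := hr
    dsimp only at hl₁
    have hs₂ := sz_append l₁ l₂
    have hs₁ := one_le_sz l₁
    have := hle x' l₁ (hl₁ ▸ List.prefix_append _ _)
    rw [hl₁] at hs₂
    simp only [sz_prod]
    omega

theorem foldl_of_growth {S : Type} [Enc S] {l : X → List A} {s : X → S} {step : X → S → A → S}
    {growth : X × A → ℕ} (hl : PolyTime Os l) (hs : PolyTime Os s)
    (hstep : PolyTime Os fun q : X × S × A => step q.1 q.2.1 q.2.2) (hgrowth : PolyBounded growth)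
    (hle : ∀ x s a, sz (step x s a) ≤ sz s + growth (x, a)) :
    PolyTime Os fun x => (l x).foldl (step x) (s x) := by
  obtain ⟨b, hb⟩ := hgrowth
  have := hl.polyBounded_sz
  have := hs.polyBounded_sz
  refine hl.foldl hs hstep (bound := fun x => sz (s x) + sz (l x) * b.eval (sz x + sz (l x) + 1))
    (by fun_prop) fun x l' hl' => ?_
  have hfold : ∀ (l' : List A) (s : S), (∀ a ∈ l', a ∈ l x) →
      sz (l'.foldl (step x) s) ≤ sz s + l'.length * b.eval (sz x + sz (l x) + 1) := by
    intro l'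
    induction l' with
    | nil => simp
    | cons a l' ih =>
      intro s h
      have hl' := ih (step x s a) fun a ha => h a (by simp [ha])
      have ha : growth (x, a) ≤ b.eval (sz x + sz (l x) + 1) :=
        (hb _).trans (polynomial_eval_mono b (by
          have := sz_le_of_mem (h a (by simp)); simp only [sz_prod]; omega))
      have := hle x s a
      rw [List.foldl_cons, List.length_cons, add_mul]
      omega
  have hlen : l'.length ≤ sz (l x) := hl'.length_le.trans (length_lt_sz _).le
  exact (hfold l' (s x) fun a ha => hl'.subset ha).trans (by gcongr)

end PolyTime

end PolyTime

section Lists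

variable {X A B : Type} [Enc X] [Enc A] [Enc B] {Os : Set (Val → Val)}

namespace PolyTime

@[fun_prop]
theorem cons {f : X → A} {l : X → List A} (hf : PolyTime Os f) (hl : PolyTime Os l) :
    PolyTime Os fun x => f x :: l x :=
  (of_enc_eq (f := fun y : A × List A => y.1 :: y.2) fun _ => rfl).comp (hf.pair hl)

theorem reverse_append {l l' : X → List A} (hl : PolyTime Os l) (hl' : PolyTime Os l') :
    PolyTime Os fun x => (l x).reverse ++ l' x := by
  refine (hl.foldl_of_growth hl' (step := fun _ s a => a :: s) (growth := fun q => sz q)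
    (by fun_prop) .sz_self fun x s a => ?_).congr fun x => List.foldl_flip_cons_eq_append'.symm
  simp only [sz_cons, sz_prod]
  omega

@[fun_prop]
theorem reverse {l : X → List A} (hl : PolyTime Os l) : PolyTime Os fun x => (l x).reverse :=
  (hl.reverse_append (const [])).congr fun _ => (List.append_nil _).symm

@[fun_prop]
theorem append {l l' : X → List A} (hl : PolyTime Os l) (hl' : PolyTime Os l') :
    PolyTime Os fun x => l x ++ l' x :=
  (hl.reverse.reverse_append hl').congr fun _ => by rw [List.reverse_reverse]

@[fun_prop]
theorem flatMap {l : X → List A} {f : X → A → List B} (hl : PolyTime Os l)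
    (hf : PolyTime Os fun q : X × A => f q.1 q.2) : PolyTime Os fun x => (l x).flatMap (f x) := by
  refine (hl.foldl_of_growth (const []) (step := fun x s a => s ++ f x a) ?_ hf.polyBounded_sz
    fun x s a => ?_).congr fun x => by
      rw [List.foldl_append_eq_append, List.nil_append, List.flatMap_def]
  · exact id.snd.fst.append (hf.comp (id.fst.pair id.snd.snd))
  · change sz (s ++ f x a) ≤ sz s + sz (f x a)
    have := sz_append s (f x a)
    omega

@[fun_prop]
theorem map {l : X → List A} {f : X → A → B} (hl : PolyTime Os l)
    (hf : PolyTime Os fun q : X × A => f q.1 q.2) : PolyTime Os fun x => (l x).map (f x) :=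
  (hl.flatMap (f := fun x a => [f x a]) (hf.cons (const []))).congr fun _ => List.map_eq_flatMap

theorem map_const {J : Type} (js : List J) {f : J → X → B} (hf : ∀ j ∈ js, PolyTime Os (f j)) :
    PolyTime Os fun x => js.map fun j => f j x := by
  induction js with
  | nil => exact const []
  | cons j js ih => exact (hf j (by simp)).cons (ih fun j hj => hf j (by simp [hj]))

theorem any {l : X → List A} {c : X → A → Bool} (hl : PolyTime Os l)
    (hc : PolyTime Os fun q : X × A => c q.1 q.2) : PolyTime Os fun x => (l x).any (c x) := by
  have hfold : ∀ (x : X) (l : List A) (s : Bool),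
      l.foldl (fun s a => s || c x a) s = (s || l.any (c x)) := fun x l => by
    induction l with
    | nil => simp
    | cons a l ih => intro s; simp [ih, Bool.or_assoc]
  refine (hl.foldl_of_growth (const false) (step := fun x s a => s || c x a)
    (growth := fun _ => 2) (id.snd.fst.or (hc.comp (id.fst.pair id.snd.snd))) (.const 2)
    fun x s a => ?_).congr fun x => by rw [hfold, Bool.false_or]
  exact (sz_bool_le _).trans (Nat.le_add_left _ _)

theorem decide_mem [DecidableEq A] (hA : Function.Injective (enc : A → Val)) {y : X → A}
    {l : X → List A} (hy : PolyTime Os y) (hl : PolyTime Os l) :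
    PolyTime Os fun x => decide (y x ∈ l x) :=
  (hl.any (c := fun x a => decide (a = y x)) (decide_eq hA id.snd (hy.comp id.fst))).congr
    fun x => by simp [List.any_eq]

theorem dedup [DecidableEq A] (hA : Function.Injective (enc : A → Val)) {l : X → List A}
    (hl : PolyTime Os l) : PolyTime Os fun x => (l x).dedup := by
  refine (hl.reverse.foldl_of_growth (const []) (growth := fun q => sz q)
    (step := fun _ s a => bif decide (a ∈ s) then s else a :: s)
    ((decide_mem hA id.snd.snd id.snd.fst).cond id.snd.fst (by fun_prop)) .sz_self
    fun x s a => ?_).congr fun x => ?_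
  · cases decide (a ∈ s)
    · simp only [cond_false, sz_cons, sz_prod]; omega
    · exact Nat.le_add_right _ _
  · rw [List.foldl_reverse, ← List.append_nil (l x), List.dedup_append, List.append_nil,
      List.dedup_nil, List.union_def]
    exact List.foldr_ext _ _ _ fun a _ s => by by_cases h : a ∈ s <;> simp [h]

@[fun_prop]
theorem length {l : X → List A} (hl : PolyTime Os l) : PolyTime Os fun x => (l x).length := by
  refine (hl.foldl_of_growth (const 0) (step := fun _ s _ => s + 1) (growth := fun _ => 2)
    (by fun_prop) (.const 2) fun _ s _ => ?_).congr fun x => by simp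
  have := size_add_le s 1
  simp only [sz_nat, Nat.size_one] at *
  omega

end PolyTime

omit [Enc A] in
theorem sz_foldl_append_le {block : ℕ → A → List B} {W N C : ℕ} {l : List A} {r : List B}
    (hW : ∀ n a, (block n a).length ≤ W) (hN : r.length + l.length * W ≤ N)
    (hC : ∀ n ≤ N, ∀ a ∈ l, sz (block n a) ≤ C) :
    sz (l.foldl (fun r a => r ++ block r.length a) r) ≤ sz r + l.length * C := by
  induction l generalizing r with
  | nil => simp
  | cons a l ih =>
    rw [List.length_cons, add_mul] at hN ⊢
    have hl := ih (r := r ++ block r.length a)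
      (by have := hW r.length a; rw [List.length_append]; omega)
      fun n hn a ha => hC n hn a (by simp [ha])
    have hblock := hC r.length (by omega) a (by simp)
    have hr := sz_append r (block r.length a)
    rw [List.foldl_cons]
    omega

theorem PolyTime.foldl_append {l : X → List A} {s : X → List B} {block : X → ℕ → A → List B}
    {W : ℕ} (hl : PolyTime Os l) (hs : PolyTime Os s)
    (hb : PolyTime Os fun q : X × ℕ × A => block q.1 q.2.1 q.2.2)
    (hW : ∀ x n a, (block x n a).length ≤ W) :
    PolyTime Os fun x => (l x).foldl (fun r a => r ++ block x r.length a) (s x) := by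
  obtain ⟨c, hc⟩ := hb.polyBounded_sz
  have := hl.polyBounded_sz
  have := hs.polyBounded_sz
  refine hl.foldl hs (step := fun x r a => r ++ block x r.length a)
    (bound := fun x => sz (s x) +
      sz (l x) * c.eval (sz x + (sz (s x) + sz (l x) * W + 1 + sz (l x) + 1) + 1))
    (id.snd.fst.append (hb.comp (id.fst.pair (id.snd.fst.length.pair id.snd.snd))))
    (by fun_prop) fun x l' hl' => ?_
  have hlen : l'.length ≤ sz (l x) := hl'.length_le.trans (length_lt_sz _).le
  refine (sz_foldl_append_le (hW x) (N := sz (s x) + sz (l x) * W) (C := _) ?_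
    fun n hn a ha => (hc (x, n, a)).trans (polynomial_eval_mono c ?_)).trans
    (Nat.add_le_add_left (Nat.mul_le_mul_right _ hlen) _)
  · have := (length_lt_sz (s x)).le
    gcongr
  · have hsize : Nat.size n ≤ n := Nat.size_le.2 Nat.lt_two_pow_self
    have ha := sz_le_of_mem (hl'.subset ha)
    simp only [sz_prod, sz_nat]
    omega

theorem PolyTime.finite_cases {K : Type} [Finite K] [DecidableEq K] {kind : X → K} {f : K → X → B}
    (hk : ∀ c, PolyTime Os fun x => decide (kind x = c)) (hf : ∀ c, PolyTime Os (f c)) :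
    PolyTime Os fun x => f (kind x) x := by
  have := Fintype.ofFinite K
  obtain hX | ⟨⟨x₀⟩⟩ := isEmpty_or_nonempty X
  · exact of_op .id hX.elim ⟨0, hX.elim⟩
  have hcases : ∀ L : List K, ∃ g : X → B, PolyTime Os g ∧
      ∀ x, kind x ∈ L → g x = f (kind x) x := by
    intro L
    induction L with
    | nil => exact ⟨_, const (f (kind x₀) x₀), by simp⟩
    | cons c L ih =>
      obtain ⟨g, hg, hgL⟩ := ih
      refine ⟨_, (hk c).cond (hf c) hg, fun x hx => ?_⟩
      by_cases h : kind x = c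
      · simp [h]
      · simpa [h] using hgL x (by simpa [h] using hx)
  obtain ⟨g, hg, hgL⟩ := hcases Finset.univ.toList
  exact hg.congr fun x => (hgL x (by simp)).symm

instance {m : ℕ} : Enc (Fin m → A) := ⟨fun f => enc (List.ofFn f)⟩

@[fun_prop]
theorem PolyTime.pi {m : ℕ} {f : X → Fin m → A} (hf : ∀ i, PolyTime Os fun x => f x i) :
    PolyTime Os fun x i => f x i := by
  have h : PolyTime Os fun x => (List.finRange m).map fun i => f x i := .map_const _ fun i _ => hf i
  simp only [← List.ofFn_eq_map] at h
  exact h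

@[fun_prop]
theorem PolyTime.apply {m : ℕ} (i : Fin m) : PolyTime Os fun f : Fin m → A => f i := by
  induction m with
  | zero => exact i.elim0
  | succ m ih =>
    have h : PolyTime Os fun f : Fin (m + 1) → A => (f 0, fun i : Fin m => f i.succ) :=
      .of_enc_eq fun f => by
        change _ = enc (List.ofFn f)
        rw [List.ofFn_succ]
        rfl
    exact Fin.cases h.fst (fun i => (ih i).comp h.snd) i

end Lists

section Arithmetic

variable {X : Type} [Enc X] {Os : Set (Val → Val)}

/-- The product of the two arguments at least halves in each step of Euclid's algorithm. -/
theorem two_mul_mod_mul_le {a b : ℕ} (hba : b ≤ a) : 2 * (a % b * b) ≤ b * a := by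
  rcases b.eq_zero_or_pos with rfl | hb
  · simp
  · have hdiv : 1 ≤ a / b := (Nat.one_le_div_iff hb).2 hba
    have hmod := Nat.mod_add_div a b
    have hlt := Nat.mod_lt a hb
    have : 2 * (a % b) ≤ a := by nlinarith
    nlinarith

theorem size_lt_size_of_two_mul_le {m n : ℕ} (hn : 0 < n) (h : 2 * m ≤ n) :
    Nat.size m < Nat.size n := by
  obtain ⟨k, hk⟩ := Nat.exists_eq_succ_of_ne_zero (Nat.size_pos.2 hn).ne'
  rw [hk, Nat.lt_succ_iff, Nat.size_le]
  have := Nat.lt_size_self n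
  rw [hk, pow_succ] at this
  omega

namespace PolyTime

@[fun_prop]
theorem gcd {f g : X → ℕ} (hf : PolyTime Os f) (hg : PolyTime Os g) :
    PolyTime Os fun x => Nat.gcd (f x) (g x) := by
  -- The loop maps `(b, a)` to `(a % b, b)`; starting from `b ≤ a` keeps this invariant true.
  suffices h : PolyTime Os fun q : ℕ × ℕ => ((0 : ℕ), Nat.gcd q.1 (q.2 + q.1)) from
    (h.comp (hf.pair hg)).snd.congr fun x => by simp
  have hsum (q : ℕ × ℕ) : Nat.size (q.2 + q.1) ≤ sz q := by
    have := size_add_le q.2 q.1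
    rw [sz_prod q, sz_nat, sz_nat]
    omega
  refine loop (S := ℕ × ℕ) (P := ℕ × ℕ) (step := fun q => (q.2 % q.1, q.1))
    (start := fun q => (q.1, q.2 + q.1))
    (I := fun q s => s.1 ≤ s.2 ∧ s.2 ≤ q.2 + q.1 ∧ Nat.gcd s.1 s.2 = Nat.gcd q.1 (q.2 + q.1))
    (μ := fun s => Nat.size (s.1 * s.2)) (bound := fun q => 2 * sz q + 3)
    (by fun_prop) (by fun_prop) (fun q => ⟨Nat.le_add_left _ _, le_rfl, rfl⟩) ?_ (by fun_prop)
    ?_ (fun s => ?_) fun q => ⟨Nat.zero_le _, ?_, Nat.gcd_zero_left _⟩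
  · rintro q ⟨b, a⟩ ⟨hba, ha, hgcd⟩
    rcases b.eq_zero_or_pos with rfl | hb
    · exact .inl ⟨rfl, by rw [← hgcd, Nat.gcd_zero_left]⟩
    · exact .inr ⟨fun h => hb.ne' (Val.nat.inj h), (b, a), rfl,
        ⟨(Nat.mod_lt a hb).le, hba.trans ha, (Nat.gcd_rec b a).symm.trans hgcd⟩,
        size_lt_size_of_two_mul_le (Nat.mul_pos hb (hb.trans_le hba)) (two_mul_mod_mul_le hba)⟩
  · rintro q ⟨b, a⟩ ⟨hba, ha, -⟩
    have hq := hsum q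
    have hsa := Nat.size_le_size ha
    have hsb := Nat.size_le_size hba
    rw [sz_prod, sz_nat, sz_nat]
    omega
  · exact (size_mul_le _ _).trans (by rw [sz_prod s, sz_nat, sz_nat]; omega)
  · rcases q.1.eq_zero_or_pos with h | h
    · simp [h]
    · exact (Nat.gcd_le_left _ h).trans (Nat.le_add_left _ _)

end PolyTime

instance : Enc ℚ := ⟨encRat⟩

namespace PolyTime

@[fun_prop]
theorem toNat_num {q : X → ℚ} (hq : PolyTime Os q) : PolyTime Os fun x => (q x).num.toNat :=
  ((of_enc_eq (f := fun q : ℚ => ((q.num.toNat, (-q.num).toNat), q.den)) fun _ => rfl).comp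
    hq).fst.fst

@[fun_prop]
theorem den {q : X → ℚ} (hq : PolyTime Os q) : PolyTime Os fun x => (q x).den :=
  ((of_enc_eq (f := fun q : ℚ => ((q.num.toNat, (-q.num).toNat), q.den)) fun _ => rfl).comp hq).snd

end PolyTime

theorem enc_natCast_div (m n : ℕ) : enc ((m : ℚ) / (n : ℚ)) =
    enc (bif decide (n = 0) then ((0, 0), 1) else ((m / Nat.gcd m n, 0), n / Nat.gcd m n)) := by
  by_cases hn : n = 0
  · subst hn
    simp [enc, encRat, encInt]
  · have hdiv : (m : ℚ) / n = Rat.normalize m n hn := by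
      rw [Rat.normalize_eq_mkRat, Rat.mkRat_eq_div, Int.cast_natCast]
    have hnum : ((m : ℤ) / (Nat.gcd m n : ℤ)).toNat = m / Nat.gcd m n := by
      rw [← Int.natCast_div, Int.toNat_natCast]
    have hneg : (-((m : ℤ) / (Nat.gcd m n : ℤ))).toNat = 0 :=
      Int.toNat_of_nonpos (neg_nonpos.2 (by positivity))
    simp [hdiv, hn, Rat.normalize_eq, enc, encRat, encInt, hnum, hneg]

@[fun_prop]
theorem PolyTime.natCast_div {f g : X → ℕ} (hf : PolyTime Os f) (hg : PolyTime Os g) :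
    PolyTime Os fun x => (f x : ℚ) / (g x : ℚ) := by
  have h : PolyTime Os fun x => bif decide (g x = 0) then (((0 : ℕ), (0 : ℕ)), (1 : ℕ)) else
      ((f x / Nat.gcd (f x) (g x), 0), g x / Nat.gcd (f x) (g x)) := by
    fun_prop
  exact h.congr_enc fun x => enc_natCast_div _ _

end Arithmetic

/-! ### Boolean functions of equal Euler characteristic -/

section Euler

variable {V : Type} [DecidableEq V]

/-- The Boolean function `φ` with its values at the sets of odd cardinality negated. The Euler
characteristic of `φ` counts, up to a constant, the sets on which the twisted function is true. -/
def twist (φ : BoolFun V) : BoolFun V := fun ν => φ ν ^^ decide (Odd ν.card)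

omit [DecidableEq V] in
theorem twist_twist (φ : BoolFun V) : twist (twist φ) = φ := by
  funext ν
  simp [twist]

theorem eul_add_card_odd [Fintype V] (φ : BoolFun V) :
    eul φ + (Finset.univ.filter fun ν : Finset V => Odd ν.card).card =
      Fintype.card {ν : Finset V // twist φ ν = true} := by
  rw [eul, Fintype.card_subtype, Finset.card_filter, Finset.card_filter, Finset.sum_filter]
  push_cast
  rw [← Finset.sum_add_distrib]
  refine Finset.sum_congr rfl fun ν _ => ?_
  rcases Nat.even_or_odd ν.card with h | h
  · simp [twist, h.neg_one_pow, Nat.not_odd_iff_even.2 h]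
  · cases hφ : φ ν <;> simp [twist, h.neg_one_pow, h, hφ]

theorem exists_perm_twist_of_eul_eq [Fintype V] {φ φ' : BoolFun V} (h : eul φ = eul φ') :
    ∃ σ : Equiv.Perm (Finset V), twist φ' = twist φ ∘ σ := by
  have hcard : Fintype.card {ν // twist φ' ν = true} = Fintype.card {ν // twist φ ν = true} := by
    have h₁ := eul_add_card_odd φ
    have h₂ := eul_add_card_odd φ'
    omega
  obtain ⟨e⟩ := Fintype.card_eq.1 hcard
  refine ⟨e.extendSubtype, funext fun ν => ?_⟩
  by_cases hν : twist φ' ν = true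
  · rw [hν, Function.comp_apply, e.extendSubtype_mem ν hν]
  · rw [Bool.eq_false_iff.2 hν, Function.comp_apply,
      Bool.eq_false_iff.2 (e.extendSubtype_not_mem ν hν)]

theorem closure_swap_insert [Finite V] : Subgroup.closure
    {σ : Equiv.Perm (Finset V) | ∃ ν, ∃ i ∉ ν, σ = Equiv.swap ν (insert i ν)} = ⊤ := by
  set H := Subgroup.closure
    {σ : Equiv.Perm (Finset V) | ∃ ν, ∃ i ∉ ν, σ = Equiv.swap ν (insert i ν)}
  have hempty (ν : Finset V) : Equiv.swap ∅ ν ∈ H := by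
    induction ν using Finset.induction_on with
    | empty => exact Equiv.swap_self (∅ : Finset V) ▸ H.one_mem
    | insert i ν hi ih =>
      exact SubmonoidClass.swap_mem_trans H ih (Subgroup.subset_closure ⟨ν, i, hi, rfl⟩)
  rw [eq_top_iff, ← Equiv.Perm.closure_isSwap, Subgroup.closure_le]
  rintro _ ⟨ν, μ, -, rfl⟩
  exact SubmonoidClass.swap_mem_trans H (Equiv.swap_comm ∅ ν ▸ hempty ν) (hempty μ)

theorem erase_eq_iff {i : V} {ν μ : Finset V} (hi : i ∉ ν) :
    μ.erase i = ν ↔ μ = ν ∨ μ = insert i ν := by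
  constructor
  · rintro rfl
    by_cases h : i ∈ μ
    · exact .inr (Finset.insert_erase h).symm
    · exact .inl (Finset.erase_eq_of_notMem h).symm
  · rintro (rfl | rfl)
    · exact Finset.erase_eq_of_notMem hi
    · exact Finset.erase_insert hi

theorem twist_comp_swap (φ : BoolFun V) {ν : Finset V} {i : V} (hi : i ∉ ν) (μ : Finset V) :
    twist (twist φ ∘ Equiv.swap ν (insert i ν)) μ =
      if μ = ν then !φ (insert i ν) else if μ = insert i ν then !φ ν else φ μ := by
  by_cases h : μ = ν
  · subst h
    simp [twist, Finset.card_insert_of_notMem hi, Nat.odd_add_one, -Nat.not_odd_iff_even]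
  · by_cases h' : μ = insert i ν
    · subst h'
      simp [twist, Finset.card_insert_of_notMem hi, Nat.odd_add_one, h, -Nat.not_odd_iff_even]
    · simp [twist, h, h', Equiv.swap_apply_of_ne_of_ne]

theorem twist_comp_swap_induction {P : BoolFun V → Prop} (hcompl : ∀ φ, P φ → P fun ν => !φ ν)
    (hadd : ∀ φ ν i, (∀ μ, μ.erase i = ν → φ μ = false) → P φ →
      P fun μ => φ μ || decide (μ.erase i = ν))
    {φ : BoolFun V} {ν : Finset V} {i : V} (hi : i ∉ ν) (hφ : P φ) :
    P (twist (twist φ ∘ Equiv.swap ν (insert i ν))) := by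
  rcases Bool.eq_or_eq_not (φ (insert i ν)) (φ ν) with h' | h'
  · cases h : φ ν <;> rw [h] at h'
    · have hμ (μ : Finset V) : twist (twist φ ∘ Equiv.swap ν (insert i ν)) μ =
          (φ μ || decide (μ.erase i = ν)) := by
        simp only [twist_comp_swap φ hi, erase_eq_iff hi]
        split_ifs <;> simp_all
      rw [funext hμ]
      refine hadd φ ν i (fun μ hμ => ?_) hφ
      obtain rfl | rfl := (erase_eq_iff hi).1 hμ <;> assumption
    · have hμ (μ : Finset V) : twist (twist φ ∘ Equiv.swap ν (insert i ν)) μ =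
          !(!φ μ || decide (μ.erase i = ν)) := by
        simp only [twist_comp_swap φ hi, erase_eq_iff hi]
        split_ifs <;> simp_all
      rw [funext hμ]
      refine hcompl _ (hadd _ ν i (fun μ hμ => ?_) (hcompl φ hφ))
      obtain rfl | rfl := (erase_eq_iff hi).1 hμ <;> simp [h, h']
  · have hμ (μ : Finset V) : twist (twist φ ∘ Equiv.swap ν (insert i ν)) μ = φ μ := by
      rw [twist_comp_swap φ hi]
      split_ifs <;> simp_all
    rwa [funext hμ]

theorem eul_induction [Fintype V] {P : BoolFun V → Prop} (hcompl : ∀ φ, P φ → P fun ν => !φ ν)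
    (hadd : ∀ φ ν i, (∀ μ, μ.erase i = ν → φ μ = false) → P φ →
      P fun μ => φ μ || decide (μ.erase i = ν))
    {φ φ' : BoolFun V} (h : eul φ = eul φ') (hφ : P φ) : P φ' := by
  have hperm (σ : Equiv.Perm (Finset V)) : ∀ φ, P φ ↔ P (twist (twist φ ∘ σ)) := by
    have hσ : σ ∈ Subgroup.closure
        {σ : Equiv.Perm (Finset V) | ∃ ν, ∃ i ∉ ν, σ = Equiv.swap ν (insert i ν)} :=
      closure_swap_insert (V := V) ▸ Subgroup.mem_top σ
    induction hσ using Subgroup.closure_induction with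
    | mem σ hσ =>
      obtain ⟨ν, i, hi, rfl⟩ := hσ
      have hswap := fun φ => twist_comp_swap_induction (φ := φ) hcompl hadd hi
      refine fun φ => ⟨hswap φ, fun h => ?_⟩
      simpa [Function.comp_assoc, ← Equiv.Perm.coe_mul, twist_twist] using hswap _ h
    | one => simp [twist_twist]
    | mul σ τ _ _ hσ hτ =>
      intro φ
      rw [hσ, hτ, twist_twist, Equiv.Perm.coe_mul, Function.comp_assoc]
    | inv σ _ hσ =>
      intro φ
      rw [hσ (twist (twist φ ∘ _)), twist_twist, Function.comp_assoc, ← Equiv.Perm.coe_mul,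
        inv_mul_cancel, Equiv.Perm.coe_one, Function.comp_id, twist_twist]
  obtain ⟨σ, hσ⟩ := exists_perm_twist_of_eul_eq h
  rw [← twist_twist φ', hσ]
  exact (hperm σ φ).1 hφ

end Euler

/-! ### An automaton that reads the facts of a database -/

section Automaton

variable {k : ℕ}

/-- The constants of a fact. -/
def Fact.consts : Fact k → List ℕ
  | .R a => [a]
  | .S _ a b => [a, b]
  | .T a => [a]

/-- The index of the predicate, for binary facts. -/
def Fact.kind : Fact k → Option (Fin k)
  | .S j _ _ => some j
  | _ => none

/-- The fact that forms, together with a binary fact of kind `j`, a match of the query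
`h_{k, i.succAbove j}`. -/
def partner (i : Fin (k + 1)) : Fact k → Fact k
  | .S j a b => if j.castSucc < i then firstAtom j.castSucc a b else secondAtom j.succ a b
  | t => t

/-- Whether the partner of the facts of kind `j` is a unary fact. -/
def isInitial (i : Fin (k + 1)) (j : Fin k) : Bool :=
  if j.castSucc < i then decide (j.val = 0) else decide (j.val + 1 = k)

theorem firstAtom_castSucc (j : Fin k) (a b : ℕ) : firstAtom j.castSucc a b =
    if j.val = 0 then .R a else .S ⟨j.val - 1, by omega⟩ a b := by
  obtain ⟨_ | j, hj⟩ := j <;> rfl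

theorem secondAtom_succ (j : Fin k) (a b : ℕ) : secondAtom j.succ a b =
    if h : j.val + 1 = k then .T b else .S ⟨j.val + 1, by omega⟩ a b := by
  split_ifs with h
  · rw [show j.succ = Fin.last k from Fin.ext h, secondAtom, Fin.lastCases_last]
  · rw [show j.succ = Fin.castSucc ⟨j.val + 1, by omega⟩ from rfl, secondAtom,
      Fin.lastCases_castSucc]

theorem hk_succAbove (i : Fin (k + 1)) (j : Fin k) (W : Database k) :
    hk (i.succAbove j) W ↔ ∃ t ∈ W, t.kind = some j ∧ partner i t ∈ W := by
  have hS : (∃ t ∈ W, t.kind = some j ∧ partner i t ∈ W) ↔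
      ∃ a b, .S j a b ∈ W ∧ partner i (.S j a b) ∈ W := by
    constructor
    · rintro ⟨_ | ⟨j', a, b⟩ | _, ht, ⟨⟩, hp⟩
      exact ⟨a, b, ht, hp⟩
    · rintro ⟨a, b, ht, hp⟩
      exact ⟨_, ht, rfl, hp⟩
  rw [hS]
  simp only [hk, partner]
  by_cases h : j.castSucc < i
  · simp only [Fin.succAbove_of_castSucc_lt i j h, h, if_true, and_comm, secondAtom,
      Fin.lastCases_castSucc]
  · simp only [Fin.succAbove_of_le_castSucc i j (not_lt.1 h), h, if_false, firstAtom,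
      Fin.cases_succ]

/-- A state: the queries satisfied so far, the value of the last unary fact, and the value of the
last binary fact. -/
abbrev State (k : ℕ) := Finset (Fin (k + 1)) × Bool × Bool

/-- The transition on reading a fact of the given kind and truth value. -/
def State.step (i : Fin (k + 1)) (c : Option (Fin k)) (s : State k) (v : Bool) : State k :=
  match c with
  | none => (s.1, v, s.2.2)
  | some j => (if (bif isInitial i j then s.2.1 else s.2.2) && v then insert (i.succAbove j) s.1
      else s.1, s.2.1, v)

/-- The state reached after reading the facts of `L` with their values in the world `W`. -/
def State.run (i : Fin (k + 1)) (W : Database k) (L : List (Fact k)) (s : State k) : State k :=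
  L.foldl (fun s t => s.step i t.kind (decide (t ∈ W))) s

/-- Where `L` is read after the unary fact `u` and the binary fact `v`, the partner of each binary
fact of `L` is the last unary or the last binary fact read before it, as `isInitial` requires. -/
def Coherent (i : Fin (k + 1)) : Fact k → Fact k → List (Fact k) → Prop
  | _, _, [] => True
  | u, v, t :: L => match t.kind with
    | none => Coherent i t v L
    | some j => partner i t = (bif isInitial i j then u else v) ∧ Coherent i u t L

theorem Coherent.mem_run {i : Fin (k + 1)} {u v : Fact k} {L : List (Fact k)}
    (h : Coherent i u v L) {W : Database k} {s : State k} (hu : s.2.1 = decide (u ∈ W))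
    (hv : s.2.2 = decide (v ∈ W)) (x : Fin (k + 1)) : x ∈ (State.run i W L s).1 ↔
      x ∈ s.1 ∨ ∃ t ∈ L, ∃ j, t.kind = some j ∧ x = i.succAbove j ∧ t ∈ W ∧ partner i t ∈ W := by
  induction L generalizing u v s with
  | nil => simp [State.run]
  | cons t L ih =>
    rw [State.run, List.foldl_cons, ← State.run]
    unfold Coherent at h
    cases hj : t.kind with
    | none =>
      rw [hj] at h
      rw [ih (s := s.step i none (decide (t ∈ W))) h rfl hv]
      simp [State.step, hj]
    | some j =>
      rw [hj] at h
      rw [ih (s := s.step i (some j) (decide (t ∈ W))) h.2 hu rfl]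
      have hstep : x ∈ (s.step i (some j) (decide (t ∈ W))).1 ↔
          x ∈ s.1 ∨ x = i.succAbove j ∧ t ∈ W ∧ partner i t ∈ W := by
        simp only [State.step, hu, hv, h.1]
        cases isInitial i j <;> grind
      rw [hstep, or_assoc]
      simp [hj]

/-- The facts `u a` for the constants `a` of `A`, each followed by the facts `c a b t` for all
constants `b` of `A` and all `t`. -/
def sweep {n : ℕ} (u : ℕ → Fact k) (c : ℕ → ℕ → Fin n → Fact k) (A : List ℕ) : List (Fact k) :=
  A.flatMap fun a => u a :: A.flatMap fun b => List.ofFn (c a b)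

section Sweep

variable {i : Fin (k + 1)} {n : ℕ} {u : ℕ → Fact k} {c : ℕ → ℕ → Fin n → Fact k}
  {f : Fin n → Fin k} {A : List ℕ} {L : List (Fact k)}

theorem coherent_ofFn_append {u v : Fact k} {c : Fin n → Fact k}
    (hc : ∀ t, (c t).kind = some (f t))
    (hp : ∀ t, partner i (c t) = bif isInitial i (f t) then u else
      if t.val = 0 then v else c ⟨t.val - 1, by omega⟩) (hL : ∀ v, Coherent i u v L) :
    Coherent i u v (List.ofFn c ++ L) := by
  induction n generalizing v with
  | zero => exact hL v
  | succ n ih =>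
    rw [List.ofFn_succ, List.cons_append]
    unfold Coherent
    rw [hc]
    refine ⟨hp 0, ih (fun t => hc t.succ) fun t => (hp t.succ).trans ?_⟩
    congr 1
    obtain ⟨_ | t, ht⟩ := t <;> rfl

theorem coherent_flatMap_append {A : Type} {B : A → List (Fact k)} {u v : Fact k}
    (hB : ∀ a v L, (∀ v, Coherent i u v L) → Coherent i u v (B a ++ L)) (l : List A)
    (hL : ∀ v, Coherent i u v L) : Coherent i u v (l.flatMap B ++ L) := by
  induction l generalizing v with
  | nil => exact hL v
  | cons a l ih =>
    rw [List.flatMap_cons, List.append_assoc]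
    exact hB a v _ fun v => ih

theorem coherent_sweep_append (hu : ∀ a, (u a).kind = none)
    (hc : ∀ a b t, (c a b t).kind = some (f t))
    (hp : ∀ a b v t, partner i (c a b t) = bif isInitial i (f t) then u a else
      if t.val = 0 then v else c a b ⟨t.val - 1, by omega⟩)
    (hL : ∀ u v, Coherent i u v L) (u' v : Fact k) : Coherent i u' v (sweep u c A ++ L) := by
  have hblock (l : List ℕ) : ∀ u' v, Coherent i u' v
      ((l.flatMap fun a => u a :: A.flatMap fun b => List.ofFn (c a b)) ++ L) := by
    induction l with
    | nil => exact hL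
    | cons a l ih =>
      intro u' v
      rw [List.flatMap_cons, List.append_assoc, List.cons_append]
      unfold Coherent
      rw [hu]
      exact coherent_flatMap_append (fun b v L hL => coherent_ofFn_append (hc a b) (hp a b v) hL) A
        (ih (u a))
  exact hblock A u' v

theorem nodup_sweep (hA : A.Nodup) (hu : u.Injective) (huc : ∀ a a' b t, u a ≠ c a' b t)
    (hc : ∀ a b t a' b' t', c a b t = c a' b' t' → a = a' ∧ b = b' ∧ t = t') :
    (sweep u c A).Nodup := by
  refine List.nodup_flatMap.2 ⟨fun a _ => List.nodup_cons.2 ⟨?_, List.nodup_flatMap.2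
    ⟨fun b _ => List.nodup_ofFn.2 fun t t' h => (hc _ _ _ _ _ _ h).2.2,
      hA.imp fun hne => ?_⟩⟩, hA.imp fun hne => ?_⟩
  · simpa [List.mem_ofFn] using fun b _ t h => huc a a b t h.symm
  · simp only [Function.onFun, List.Disjoint, List.mem_ofFn]
    rintro _ ⟨t, rfl⟩ ⟨t', h⟩
    exact hne (hc _ _ _ _ _ _ h).2.1.symm
  · simp only [Function.onFun, List.Disjoint, List.mem_cons, List.mem_flatMap, List.mem_ofFn]
    rintro _ (rfl | ⟨b, -, t, rfl⟩) (h | ⟨b', -, t', h⟩)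
    · exact hne (hu h)
    · exact huc _ _ _ _ h.symm
    · exact huc _ _ _ _ h.symm
    · exact hne (hc _ _ _ _ _ _ h).1.symm

theorem length_sweep (u : ℕ → Fact k) (c : ℕ → ℕ → Fin n → Fact k) (A : List ℕ) :
    (sweep u c A).length = A.length * (A.length * n + 1) := by
  simp [sweep, List.length_flatMap]

end Sweep

/-- The `t`-th predicate counted from the first one. -/
def upIndex (i : Fin (k + 1)) (t : Fin i) : Fin k := ⟨t, by omega⟩

/-- The `t`-th predicate counted from the last one. -/
def downIndex (i : Fin (k + 1)) (t : Fin (k - i)) : Fin k := ⟨k - 1 - t, by omega⟩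

/-- The facts over the constants `A`: first those of `R` and of the `S j` with `j < i`, grouped by
their first component; then those of `T` and of the other `S j`, grouped by their second
component. -/
def factOrder (i : Fin (k + 1)) (A : List ℕ) : List (Fact k) :=
  sweep .R (fun a b t => .S (upIndex i t) a b) A ++
    sweep .T (fun b a t => .S (downIndex i t) a b) A

theorem partner_upIndex (i : Fin (k + 1)) (a b : ℕ) (v : Fact k) (t : Fin i) :
    partner i (.S (upIndex i t) a b) = bif isInitial i (upIndex i t) then .R a else
      if t.val = 0 then v else .S (upIndex i ⟨t.val - 1, by omega⟩) a b := by
  have ht : (upIndex i t).castSucc < i := t.isLt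
  have hval : (upIndex i t).val = t := rfl
  simp only [partner, isInitial, ht, if_true, firstAtom_castSucc, hval]
  by_cases h : t.val = 0 <;> simp [h, upIndex]

theorem partner_downIndex (i : Fin (k + 1)) (b a : ℕ) (v : Fact k) (t : Fin (k - i)) :
    partner i (.S (downIndex i t) a b) = bif isInitial i (downIndex i t) then .T b else
      if t.val = 0 then v else .S (downIndex i ⟨t.val - 1, by omega⟩) a b := by
  have ht : ¬ (downIndex i t).castSucc < i := by
    have := t.isLt
    simp only [downIndex, Fin.lt_def, Fin.val_castSucc]
    omega
  have hk : (downIndex i t).val + 1 = k ↔ t.val = 0 := by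
    have := t.isLt
    simp only [downIndex]
    omega
  simp only [partner, isInitial, ht, if_false, secondAtom_succ, hk]
  by_cases h : t.val = 0
  · simp [h]
  · have hpred : k - 1 - t.val + 1 = k - 1 - (t.val - 1) := by omega
    simp [h, downIndex, hpred]

theorem coherent_factOrder (i : Fin (k + 1)) (A : List ℕ) (u v : Fact k) :
    Coherent i u v (factOrder i A) := by
  have hnil (u v : Fact k) : Coherent i u v [] := trivial
  rw [factOrder, ← List.append_nil (_ ++ _), List.append_assoc]
  exact coherent_sweep_append (fun _ => rfl) (fun _ _ _ => rfl) (partner_upIndex i)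
    (coherent_sweep_append (fun _ => rfl) (fun _ _ _ => rfl) (partner_downIndex i)
      hnil) u v

theorem mem_factOrder (i : Fin (k + 1)) (A : List ℕ) (t : Fact k) :
    t ∈ factOrder i A ↔ ∀ a ∈ t.consts, a ∈ A := by
  rw [factOrder, List.mem_append]
  simp only [sweep, List.mem_flatMap, List.mem_cons, List.mem_ofFn]
  cases t with
  | R a => simp [Fact.consts]
  | T a => simp [Fact.consts]
  | S j a b =>
    simp only [Fact.consts, List.mem_cons, List.not_mem_nil, or_false, forall_eq_or_imp, forall_eq,
      reduceCtorEq, false_or, Fact.S.injEq]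
    constructor
    · rintro (⟨c, hc, d, hd, t, -, rfl, rfl⟩ | ⟨c, hc, d, hd, t, -, rfl, rfl⟩) <;> exact ⟨‹_›, ‹_›⟩
    · rintro ⟨ha, hb⟩
      by_cases h : j.val < i.val
      · exact .inl ⟨a, ha, b, hb, ⟨j, h⟩, rfl, rfl, rfl⟩
      · refine .inr ⟨b, hb, a, ha, ⟨k - 1 - j, by omega⟩, Fin.ext ?_, rfl, rfl⟩
        simp only [downIndex]
        omega

theorem State.mem_run_factOrder (i : Fin (k + 1)) (W : Database k) (A : List ℕ)
    (hA : ∀ t ∈ W, ∀ a ∈ t.consts, a ∈ A) (x : Fin (k + 1)) :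
    x ∈ (State.run i W (factOrder i A) (∅, false, false)).1 ↔ x ≠ i ∧ hk x W := by
  have : Infinite (Fact k) := .of_injective Fact.R fun _ _ => Fact.R.inj
  obtain ⟨u, hu⟩ := Infinite.exists_notMem_finset W
  rw [(coherent_factOrder i A u u).mem_run (by simp [hu]) (by simp [hu])]
  simp only [Finset.notMem_empty, false_or]
  constructor
  · rintro ⟨t, -, j, hj, rfl, ht, hp⟩
    exact ⟨Fin.succAbove_ne i j, (hk_succAbove i j W).2 ⟨t, ht, hj, hp⟩⟩
  · rintro ⟨hx, hxW⟩
    obtain ⟨j, rfl⟩ := Fin.exists_succAbove_eq hx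
    obtain ⟨t, ht, hj, hp⟩ := (hk_succAbove i j W).1 hxW
    exact ⟨t, (mem_factOrder i A t).2 (hA t ht), j, hj, rfl, ht, hp⟩

theorem nodup_factOrder (i : Fin (k + 1)) {A : List ℕ} (hA : A.Nodup) :
    (factOrder i A).Nodup := by
  have hdown (t t' : Fin (k - i)) (h : downIndex i t = downIndex i t') : t = t' := by
    have := congrArg Fin.val h
    simp only [downIndex] at this
    omega
  refine List.nodup_append.2 ⟨nodup_sweep hA (fun _ _ => Fact.R.inj) nofun ?_,
    nodup_sweep hA (fun _ _ => Fact.T.inj) nofun ?_, ?_⟩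
  · rintro a b t a' b' t' h
    obtain ⟨ht, ha, hb⟩ := Fact.S.inj h
    exact ⟨ha, hb, Fin.ext (Fin.mk.inj ht)⟩
  · rintro b a t b' a' t' h
    obtain ⟨ht, ha, hb⟩ := Fact.S.inj h
    exact ⟨hb, ha, hdown t t' ht⟩
  · rintro t ht _ ht' rfl
    simp only [sweep, List.mem_flatMap, List.mem_cons, List.mem_ofFn] at ht ht'
    obtain ⟨a, -, rfl | ⟨b, -, s, rfl⟩⟩ := ht <;> obtain ⟨a', -, h | ⟨b', -, s', h⟩⟩ := ht'
    all_goals simp only [reduceCtorEq, Fact.S.injEq] at h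
    have := congrArg Fin.val h.1
    simp only [upIndex, downIndex] at this
    omega

theorem length_factOrder_le (i : Fin (k + 1)) (A : List ℕ) :
    (factOrder i A).length ≤ 2 * (A.length * (A.length * k + 1)) := by
  have hi : i.val ≤ k := i.is_le
  have hi' : k - i.val ≤ k := Nat.sub_le _ _
  rw [factOrder, List.length_append, length_sweep, length_sweep, two_mul]
  gcongr

end Automaton

/-! ### Building circuits layer by layer -/

section Circuits

variable {α : Type}

/-- The value of a gate in terms of the values of its inputs. -/
def Gate.value [DecidableEq α] (ν : Finset α) (val : ℕ → Bool) : Gate α → Bool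
  | .var t => decide (t ∈ ν)
  | .not j => !val j
  | .and js => js.all val
  | .or js => js.any val

theorem Gate.value_congr [DecidableEq α] {g : Gate α} {ν ν' : Finset α} {val val' : ℕ → Bool}
    (hν : ∀ t, g = .var t → (t ∈ ν ↔ t ∈ ν')) (hval : ∀ j ∈ g.inputs, val j = val' j) :
    g.value ν val = g.value ν' val' := by
  cases g with
  | var t => exact decide_eq_decide.2 (hν t rfl)
  | not j => exact congrArg (! ·) (hval j (List.mem_singleton_self j))
  | and js => exact Bool.eq_iff_iff.2 (by
      simpa only [value, List.all_eq_true] using forall₂_congr fun j hj => by rw [hval j hj])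
  | or js => exact Bool.eq_iff_iff.2 (by
      simpa only [value, List.any_eq_true] using
        exists_congr fun j => and_congr_right fun hj => by rw [hval j hj])

namespace Circuit

theorem HasVar.congr {C C' : Circuit α} {i : ℕ} {t : α} (ht : C.HasVar i t)
    (hC' : ∀ (i : ℕ) (g : Gate α), C'.gates[i]? = some g → ∀ j ∈ g.inputs, j < i)
    (h : ∀ j ≤ i, C.gates[j]? = C'.gates[j]?) : C'.HasVar i t := by
  induction ht with
  | var hg => exact .var (h _ le_rfl ▸ hg)
  | wire hg hj _ ih =>
    rw [h _ le_rfl] at hg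
    exact .wire hg hj (ih fun l hl => h l (hl.trans (hC' _ _ hg _ hj).le))

theorem HasVar.eq_var_or_exists {C : Circuit α} {i : ℕ} {t : α} (ht : C.HasVar i t) {g : Gate α}
    (hg : C.gates[i]? = some g) : g = .var t ∨ ∃ j ∈ g.inputs, C.HasVar j t := by
  cases ht with
  | var h => exact .inl (Option.some.inj (hg.symm.trans h))
  | wire h hj ht =>
    cases hg.symm.trans h
    exact .inr ⟨_, hj, ht⟩

variable [DecidableEq α]

theorem eval_eq_value {C : Circuit α} {i : ℕ} {g : Gate α} (hg : C.gates[i]? = some g)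
    (hlt : ∀ j ∈ g.inputs, j < i) (ν : Finset α) : C.eval ν i = g.value ν (C.eval ν) := by
  have hval := Gate.value_congr (g := g) (ν := ν) (ν' := ν) (fun _ _ => Iff.rfl)
    (val := fun j => if _h : j < i then C.eval ν j else false)
    fun j hj => dif_pos (hlt j hj)
  rw [eval, hg, ← hval]
  cases g with
  | not j => simp [Gate.value, hlt j (List.mem_singleton_self j)]
  | _ => rfl

theorem eval_congr {C C' : Circuit α} {ν ν' : Finset α} {i : ℕ}
    (hC : ∀ (i : ℕ) (g : Gate α), C.gates[i]? = some g → ∀ j ∈ g.inputs, j < i)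
    (h : ∀ j ≤ i, C.gates[j]? = C'.gates[j]?)
    (hν : ∀ t, Gate.var t ∈ C.gates → (t ∈ ν ↔ t ∈ ν')) : C.eval ν i = C'.eval ν' i := by
  induction i using Nat.strong_induction_on with
  | _ i ih =>
    cases hg : C.gates[i]? with
    | none => rw [eval, eval, ← h i le_rfl, hg]
    | some g =>
      have hlt := hC i g hg
      rw [eval_eq_value hg hlt, eval_eq_value ((h i le_rfl).symm.trans hg) hlt]
      exact Gate.value_congr (fun t ht => hν t (ht ▸ List.mem_of_getElem? hg))
        fun j hj => ih j (hlt j hj) fun l hl => h l (hl.trans (hlt j hj).le)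

end Circuit

/-- The variable `t` occurs below gate `i` in the list of gates `G`. -/
def GateHasVar (G : List (Gate α)) (i : ℕ) (t : α) : Prop := Circuit.HasVar ⟨G, 0⟩ i t

variable [DecidableEq α]

/-- The value of gate `i` in the list of gates `G`. -/
def gateEval (G : List (Gate α)) (ν : Finset α) (i : ℕ) : Bool := Circuit.eval ⟨G, 0⟩ ν i

/-- The conditions on a gate of number `n` of a deterministic decomposable circuit with variables
in `D`, the gates before it being given by `G`. -/
structure Admissible (D : Finset α) (G : List (Gate α)) (n : ℕ) (g : Gate α) : Prop where
  lt : ∀ j ∈ g.inputs, j < n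
  decomposable : ∀ js, g = .and js → ∀ j₁ ∈ js, ∀ j₂ ∈ js, j₁ ≠ j₂ →
    ∀ t, ¬ (GateHasVar G j₁ t ∧ GateHasVar G j₂ t)
  deterministic : ∀ js, g = .or js → ∀ j₁ ∈ js, ∀ j₂ ∈ js, j₁ ≠ j₂ →
    ∀ ν : Finset α, ¬ (gateEval G ν j₁ = true ∧ gateEval G ν j₂ = true)
  var_mem : ∀ t, g = .var t → t ∈ D

/-- The gates of a deterministic decomposable circuit with variables in `D`. -/
def DDGates (D : Finset α) (G : List (Gate α)) : Prop :=
  ∀ (i : ℕ) (g : Gate α), G[i]? = some g → Admissible D G i g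

/-- Gate `i` captures the Boolean function `f`, and depends on variables in `T` only. -/
structure Captures (G : List (Gate α)) (i : ℕ) (f : Finset α → Bool) (T : Set α) : Prop where
  lt : i < G.length
  eval : ∀ ν, gateEval G ν i = f ν
  mem : ∀ t, GateHasVar G i t → t ∈ T

/-- The gate `g` may be appended to the gates `G`, and then it captures the Boolean function `f`
and depends on variables in `T` only. -/
structure Implements (D : Finset α) (G : List (Gate α)) (g : Gate α) (f : Finset α → Bool)
    (T : Set α) : Prop where
  admissible : Admissible D G G.length g
  value : ∀ ν, g.value ν (gateEval G ν) = f ν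
  mem : ∀ t, (g = .var t ∨ ∃ j ∈ g.inputs, GateHasVar G j t) → t ∈ T

section Append

variable {D : Finset α} {G : List (Gate α)}

theorem ddGates_iff (D : Finset α) (C : Circuit α) :
    (C.IsDD ∧ ∀ t, Gate.var t ∈ C.gates → t ∈ D) ↔
      DDGates D C.gates ∧ C.out < C.gates.length := by
  have heval (hlt : ∀ (i : ℕ) (g : Gate α), C.gates[i]? = some g → ∀ j ∈ g.inputs, j < i) ν i :
      C.eval ν i = gateEval C.gates ν i :=
    Circuit.eval_congr hlt (fun _ _ => rfl) fun _ _ => Iff.rfl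
  constructor
  · rintro ⟨⟨⟨hout, hlt⟩, hand, hor⟩, hvar⟩
    refine ⟨fun i g hg => ⟨hlt i g hg, ?_, ?_, ?_⟩, hout⟩
    · rintro js rfl j₁ hj₁ j₂ hj₂ hne t ⟨ht₁, ht₂⟩
      exact hand i js hg j₁ hj₁ j₂ hj₂ hne t
        ⟨ht₁.congr hlt fun _ _ => rfl, ht₂.congr hlt fun _ _ => rfl⟩
    · rintro js rfl j₁ hj₁ j₂ hj₂ hne ν hν
      rw [← heval hlt, ← heval hlt] at hν
      exact hor i js hg j₁ hj₁ j₂ hj₂ hne ν hν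
    · rintro t rfl
      exact hvar t (List.mem_of_getElem? hg)
  · rintro ⟨h, hout⟩
    have hlt (i g) (hg : C.gates[i]? = some g) := (h i g hg).lt
    refine ⟨⟨⟨hout, hlt⟩, fun i js hg j₁ hj₁ j₂ hj₂ hne t ht => ?_,
      fun i js hg j₁ hj₁ j₂ hj₂ hne ν hν => ?_⟩, fun t ht => ?_⟩
    · exact (h i _ hg).decomposable js rfl j₁ hj₁ j₂ hj₂ hne t
        ⟨ht.1.congr hlt fun _ _ => rfl, ht.2.congr hlt fun _ _ => rfl⟩
    · rw [heval hlt, heval hlt] at hν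
      exact (h i _ hg).deterministic js rfl j₁ hj₁ j₂ hj₂ hne ν hν
    · obtain ⟨i, hi⟩ := List.mem_iff_getElem?.1 ht
      exact (h i _ hi).var_mem t rfl

theorem DDGates.eval_eq_gateEval {C : Circuit α} (h : DDGates D C.gates) (ν : Finset α) (i : ℕ) :
    C.eval ν i = gateEval C.gates ν i :=
  Circuit.eval_congr (fun i g hg => (h i g hg).lt) (fun _ _ => rfl) fun _ _ => Iff.rfl

theorem DDGates.gateEval_append (h : DDGates D G) (L : List (Gate α)) (ν : Finset α) {i : ℕ}
    (hi : i < G.length) : gateEval (G ++ L) ν i = gateEval G ν i :=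
  (Circuit.eval_congr (fun i g hg => (h i g hg).lt)
    (fun _ hj => (List.getElem?_append_left (hj.trans_lt hi)).symm) fun _ _ => Iff.rfl).symm

theorem DDGates.gateEval_inter (h : DDGates D G) (ν : Finset α) (i : ℕ) :
    gateEval G (ν ∩ D) i = gateEval G ν i := by
  refine Circuit.eval_congr (fun i g hg => (h i g hg).lt) (fun _ _ => rfl) fun t ht => ?_
  obtain ⟨i, hi⟩ := List.mem_iff_getElem?.1 ht
  simp only [Finset.mem_inter, (h i _ hi).var_mem t rfl, and_true]

theorem DDGates.gateEval_eq_value (h : DDGates D G) {i : ℕ} {g : Gate α} (hg : G[i]? = some g)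
    (ν : Finset α) : gateEval G ν i = g.value ν (gateEval G ν) :=
  Circuit.eval_eq_value hg (h i g hg).lt ν

theorem DDGates.hasVar_of_append (h : DDGates D G) {L : List (Gate α)} {i : ℕ}
    (hi : i < G.length) {t : α} (ht : GateHasVar (G ++ L) i t) : GateHasVar G i t :=
  Circuit.HasVar.congr ht (fun i g hg => (h i g hg).lt) fun _ hj =>
    List.getElem?_append_left (hj.trans_lt hi)

theorem Captures.append {i : ℕ} {f : Finset α → Bool} {T : Set α} (hi : Captures G i f T)
    (h : DDGates D G) (L : List (Gate α)) : Captures (G ++ L) i f T where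
  lt := hi.lt.trans_le (by simp)
  eval ν := (h.gateEval_append L ν hi.lt).trans (hi.eval ν)
  mem t ht := hi.mem t (h.hasVar_of_append hi.lt ht)

theorem Admissible.append {n n' : ℕ} {g : Gate α} (hg : Admissible D G n g) (h : DDGates D G)
    (hnG : n ≤ G.length) (hn : n ≤ n') (L : List (Gate α)) : Admissible D (G ++ L) n' g where
  lt j hj := (hg.lt j hj).trans_le hn
  decomposable := by
    rintro js rfl j₁ hj₁ j₂ hj₂ hne t ⟨ht₁, ht₂⟩
    exact hg.decomposable js rfl j₁ hj₁ j₂ hj₂ hne t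
      ⟨h.hasVar_of_append ((hg.lt j₁ hj₁).trans_le hnG) ht₁,
        h.hasVar_of_append ((hg.lt j₂ hj₂).trans_le hnG) ht₂⟩
  deterministic := by
    rintro js rfl j₁ hj₁ j₂ hj₂ hne ν hν
    rw [h.gateEval_append L ν ((hg.lt j₁ hj₁).trans_le hnG),
      h.gateEval_append L ν ((hg.lt j₂ hj₂).trans_le hnG)] at hν
    exact hg.deterministic js rfl j₁ hj₁ j₂ hj₂ hne ν hν
  var_mem := hg.var_mem

theorem DDGates.append (h : DDGates D G) {L : List (Gate α)}
    (hL : ∀ g ∈ L, Admissible D G G.length g) : DDGates D (G ++ L) := by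
  intro i g hg
  obtain hi | hi := lt_or_ge i G.length
  · rw [List.getElem?_append_left hi] at hg
    exact (h i g hg).append h hi.le le_rfl L
  · rw [List.getElem?_append_right hi] at hg
    exact (hL g (List.mem_of_getElem? hg)).append h le_rfl hi L

theorem DDGates.append_ofFn (h : DDGates D G) {m : ℕ} {g : Fin m → Gate α}
    {f : Fin m → Finset α → Bool} {T : Fin m → Set α}
    (hg : ∀ s, Implements D G (g s) (f s) (T s)) :
    DDGates D (G ++ List.ofFn g) ∧
      ∀ s : Fin m, Captures (G ++ List.ofFn g) (G.length + s) (f s) (T s) := by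
  have hdd : DDGates D (G ++ List.ofFn g) :=
    h.append (List.forall_mem_ofFn_iff.2 fun s => (hg s).admissible)
  have hget (s : Fin m) : (G ++ List.ofFn g)[G.length + s]? = some (g s) := by simp
  have hlt (s : Fin m) := (hg s).admissible.lt
  refine ⟨hdd, fun s => ⟨by simp, fun ν => ?_, fun t ht => (hg s).mem t ?_⟩⟩
  · rw [hdd.gateEval_eq_value (hget s), ← (hg s).value ν]
    exact Gate.value_congr (fun _ _ => Iff.rfl) fun j hj => h.gateEval_append _ _ (hlt s j hj)
  · obtain hv | ⟨j, hj, ht⟩ := Circuit.HasVar.eq_var_or_exists ht (hget s)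
    · exact .inl hv
    · exact .inr ⟨j, hj, h.hasVar_of_append (hlt s j hj) ht⟩

theorem DDGates.append_singleton (h : DDGates D G) {g : Gate α} {f : Finset α → Bool} {T : Set α}
    (hg : Implements D G g f T) : DDGates D (G ++ [g]) ∧ Captures (G ++ [g]) G.length f T := by
  obtain ⟨hdd, hcap⟩ := h.append_ofFn (g := fun _ : Fin 1 => g) fun _ => hg
  exact ⟨hdd, hcap 0⟩

namespace Implements

variable {i j : ℕ} {f f' : Finset α → Bool} {T T' : Set α}

theorem var (G : List (Gate α)) {t : α} (ht : t ∈ D) :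
    Implements D G (.var t) (fun ν => decide (t ∈ ν)) {t} :=
  ⟨⟨nofun, nofun, nofun, fun _ h => Gate.var.inj h ▸ ht⟩, fun _ => rfl, by
    simp [Gate.inputs]⟩

theorem true (D : Finset α) (G : List (Gate α)) :
    Implements D G (.and []) (fun _ => Bool.true) ∅ :=
  ⟨⟨nofun, fun _ h => Gate.and.inj h ▸ nofun, nofun, nofun⟩, fun _ => rfl, by simp [Gate.inputs]⟩

theorem false (D : Finset α) (G : List (Gate α)) :
    Implements D G (.or []) (fun _ => Bool.false) ∅ :=
  ⟨⟨nofun, nofun, fun _ h => Gate.or.inj h ▸ nofun, nofun⟩, fun _ => rfl, by simp [Gate.inputs]⟩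

theorem not (D : Finset α) (h : Captures G i f T) :
    Implements D G (.not i) (fun ν => !f ν) T := by
  refine ⟨⟨?_, nofun, nofun, nofun⟩, fun ν => congrArg (! ·) (h.eval ν), ?_⟩
  · simpa [Gate.inputs] using h.lt
  · simpa [Gate.inputs] using h.mem

theorem and (D : Finset α) (hi : Captures G i f T) (hj : Captures G j f' T')
    (hT : Disjoint T T') : Implements D G (.and [i, j]) (fun ν => f ν && f' ν) (T ∪ T') := by
  have hdisj (t) (h : GateHasVar G i t) (h' : GateHasVar G j t) : False :=
    Set.disjoint_left.1 hT (hi.mem t h) (hj.mem t h')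
  refine ⟨⟨?_, ?_, nofun, nofun⟩, fun ν => ?_, ?_⟩
  · simpa [Gate.inputs] using ⟨hi.lt, hj.lt⟩
  · rintro _ ⟨⟩
    grind
  · simp [Gate.value, hi.eval, hj.eval]
  · simpa [Gate.inputs] using fun t => Or.imp (hi.mem t) (hj.mem t)

theorem or (D : Finset α) (hi : Captures G i f T) (hj : Captures G j f' T')
    (hf : ∀ ν, ¬ (f ν ∧ f' ν)) :
    Implements D G (.or [i, j]) (fun ν => f ν || f' ν) (T ∪ T') := by
  have hdisj (ν) (h : gateEval G ν i) (h' : gateEval G ν j) : False :=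
    hf ν ⟨hi.eval ν ▸ h, hj.eval ν ▸ h'⟩
  refine ⟨⟨?_, nofun, ?_, nofun⟩, fun ν => ?_, ?_⟩
  · simpa [Gate.inputs] using ⟨hi.lt, hj.lt⟩
  · rintro _ ⟨⟩
    grind
  · simp [Gate.value, hi.eval, hj.eval]
  · simpa [Gate.inputs] using fun t => Or.imp (hi.mem t) (hj.mem t)

end Implements

end Append

end Circuits

/-! ### Circuits of automata -/

section Layers

variable {α : Type} {m : ℕ}

/-- Number of gates plus number of wires. -/
def gatesSize (G : List (Gate α)) : ℕ := (G.map fun g => 1 + g.inputs.length).sum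

theorem gatesSize_append (G G' : List (Gate α)) :
    gatesSize (G ++ G') = gatesSize G + gatesSize G' := by simp [gatesSize]

theorem gatesSize_le {G : List (Gate α)} {c : ℕ} (h : ∀ g ∈ G, g.inputs.length ≤ c) :
    gatesSize G ≤ G.length * (1 + c) := by
  refine (List.sum_le_card_nsmul _ (1 + c) ?_).trans (by simp)
  simpa using h

/-- Gates that test the last state. -/
def acceptLayer (acc : Fin m → Bool) : List (Gate α) :=
  List.ofFn fun s => if acc s then .and [] else .or []

/-- The gates for one step of an automaton with transition function `δ`, on reading the variable
`t` (or the constant false, if `present` is false), when there are already `n` gates, of which the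
last `m` ones capture acceptance from each state after the step. -/
def stepLayer (δ : Fin m → Bool → Fin m) (present : Bool) (n : ℕ) (t : α) : List (Gate α) :=
  (if present then .var t else .or []) :: .not n ::
    ((List.ofFn fun s => Gate.and [n, n - m + δ s true]) ++
      ((List.ofFn fun s => Gate.and [n + 1, n - m + δ s false]) ++
        List.ofFn fun s : Fin m => Gate.or [n + 2 + s, n + 2 + m + s]))

theorem gatesSize_acceptLayer_le (acc : Fin m → Bool) :
    gatesSize (acceptLayer (α := α) acc) ≤ m := by
  refine (gatesSize_le (c := 0) (List.forall_mem_ofFn_iff.2 fun s => ?_)).trans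
    (by simp)
  cases acc s <;> simp [Gate.inputs]

theorem length_stepLayer (δ : Fin m → Bool → Fin m) (present : Bool) (n : ℕ) (t : α) :
    (stepLayer δ present n t).length = 2 + 3 * m := by
  simp only [stepLayer, List.length_cons, List.length_append, List.length_ofFn]
  omega

theorem gatesSize_stepLayer_le (δ : Fin m → Bool → Fin m) (present : Bool) (n : ℕ) (t : α) :
    gatesSize (stepLayer δ present n t) ≤ 3 * (2 + 3 * m) := by
  refine (gatesSize_le (c := 2) ?_).trans (by rw [length_stepLayer, mul_comm])
  simp only [stepLayer, List.mem_cons, List.mem_append, List.mem_ofFn]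
  rintro _ (rfl | rfl | ⟨s, rfl⟩ | ⟨s, rfl⟩ | ⟨s, rfl⟩)
  · cases present <;> simp [Gate.inputs]
  all_goals simp [Gate.inputs]

variable [DecidableEq α]

/-- The last `m` gates capture the functions `F s`, and depend on variables in `T` only. -/
structure CapturesStates (D : Finset α) (G : List (Gate α)) (F : Fin m → Finset α → Bool)
    (T : Set α) : Prop where
  dd : DDGates D G
  le : m ≤ G.length
  captures : ∀ s : Fin m, Captures G (G.length - m + s) (F s) T

theorem capturesStates_acceptLayer {D : Finset α} {G : List (Gate α)} (h : DDGates D G)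
    (acc : Fin m → Bool) : CapturesStates D (G ++ acceptLayer acc) (fun s _ => acc s) ∅ := by
  obtain ⟨hdd, hcap⟩ := h.append_ofFn (g := fun s => if acc s then .and [] else .or [])
    (f := fun s _ => acc s) (T := fun _ => ∅) fun s => by
      cases hs : acc s
      · exact .false D G
      · exact .true D G
  exact ⟨hdd, by simp [acceptLayer], by simpa [acceptLayer] using hcap⟩

theorem implements_input (D : Finset α) (G : List (Gate α)) (t : α) :
    Implements D G (if decide (t ∈ D) then .var t else .or [])
      (fun ν => decide (t ∈ ν) && decide (t ∈ D)) {t} := by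
  by_cases ht : t ∈ D
  · simpa [ht] using Implements.var G ht
  · have := Implements.false D G
    simpa [ht] using (⟨this.1, this.2, fun t h => (this.3 t h).elim⟩ : Implements D G _ _ {t})

theorem CapturesStates.step {D : Finset α} {G : List (Gate α)} {F : Fin m → Finset α → Bool}
    {T : Set α} (h : CapturesStates D G F T) (δ : Fin m → Bool → Fin m) {t : α} (ht : t ∉ T) :
    CapturesStates D (G ++ stepLayer δ (decide (t ∈ D)) G.length t)
      (fun s ν => F (δ s (decide (t ∈ ν) && decide (t ∈ D))) ν) (insert t T) := by
  have hT : Disjoint {t} T := Set.disjoint_singleton_left.2 ht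
  obtain ⟨dd₁, input⟩ := h.dd.append_singleton (implements_input D G t)
  obtain ⟨dd₂, negated⟩ := dd₁.append_singleton (.not D input)
  have states (s : Fin m) := ((h.captures s).append h.dd _).append dd₁ [.not G.length]
  obtain ⟨dd₃, taken⟩ := dd₂.append_ofFn fun s =>
    .and D (input.append dd₁ _) (states (δ s true)) hT
  obtain ⟨dd₄, skipped⟩ := dd₃.append_ofFn fun s =>
    .and D (negated.append dd₂ _) ((states (δ s false)).append dd₂ _) hT
  obtain ⟨dd₅, next⟩ := dd₄.append_ofFn fun s =>
    .or D ((taken s).append dd₃ _) (skipped s) fun ν => by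
      cases decide (t ∈ ν) && decide (t ∈ D) <;> simp
  simp only [List.append_assoc, List.length_append, List.length_cons, List.length_nil,
    List.length_ofFn, List.cons_append, List.nil_append, add_assoc, add_left_comm, add_comm,
    Nat.reduceAdd, Set.union_self] at dd₅ next
  simp only [stepLayer, add_left_comm, add_comm]
  refine ⟨dd₅, by simp; omega, fun s => ?_⟩
  convert next s using 1
  · simp
    omega
  · ext ν
    cases decide (t ∈ ν) && decide (t ∈ D) <;> simp
  · exact Set.insert_eq t T

/-- The gates `G`, followed by a circuit for an automaton that reads the variables of `L`. The
layers are built from the end of `L` on, because each one refers to the one for the rest of the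
input. -/
def automatonGates (δ : α → Fin m → Bool → Fin m) (acc : Fin m → Bool) (D : Finset α)
    (L : List α) (G : List (Gate α)) : List (Gate α) :=
  L.reverse.foldl (fun G t => G ++ stepLayer (δ t) (decide (t ∈ D)) G.length t)
    (G ++ acceptLayer acc)

theorem automatonGates_cons (δ : α → Fin m → Bool → Fin m) (acc : Fin m → Bool) (D : Finset α)
    (t : α) (L : List α) (G : List (Gate α)) :
    automatonGates δ acc D (t :: L) G = automatonGates δ acc D L G ++
      stepLayer (δ t) (decide (t ∈ D)) (automatonGates δ acc D L G).length t := by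
  simp [automatonGates]

theorem capturesStates_automatonGates (δ : α → Fin m → Bool → Fin m) (acc : Fin m → Bool)
    {D : Finset α} {L : List α} (hL : L.Nodup) {G : List (Gate α)} (h : DDGates D G) :
    CapturesStates D (automatonGates δ acc D L G) (fun s ν =>
      acc (L.foldl (fun s t => δ t s (decide (t ∈ ν) && decide (t ∈ D))) s)) {t | t ∈ L} := by
  induction L with
  | nil => simpa [automatonGates] using capturesStates_acceptLayer h acc
  | cons t L ih =>
    rw [List.nodup_cons] at hL
    simpa only [automatonGates_cons, List.mem_cons, Set.insert_def, Set.mem_ofPred_eq,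
      List.foldl_cons] using
      (ih hL.2).step (δ t) hL.1

theorem automatonGates_prefix (δ : α → Fin m → Bool → Fin m) (acc : Fin m → Bool) (D : Finset α)
    (L : List α) (G : List (Gate α)) : ∃ G', automatonGates δ acc D L G = G ++ G' := by
  induction L with
  | nil => exact ⟨_, rfl⟩
  | cons t L ih =>
    obtain ⟨G', h⟩ := ih
    exact ⟨_, by rw [automatonGates_cons, h, List.append_assoc]⟩

theorem gatesSize_automatonGates_le (δ : α → Fin m → Bool → Fin m) (acc : Fin m → Bool)
    (D : Finset α) (L : List α) (G : List (Gate α)) :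
    gatesSize (automatonGates δ acc D L G) ≤ gatesSize G + m + L.length * (3 * (2 + 3 * m)) := by
  induction L with
  | nil => simpa [automatonGates, gatesSize_append] using gatesSize_acceptLayer_le acc
  | cons t L ih =>
    rw [automatonGates_cons, gatesSize_append, List.length_cons, add_one_mul, ← add_assoc]
    exact add_le_add ih (gatesSize_stepLayer_le _ _ _ _)

end Layers

/-! ### Circuits for pairs of adjacent valuations -/

section PairQueries

variable {k : ℕ}

/-- The number of states. -/
abbrev numStates (k : ℕ) : ℕ := Fintype.card (State k)

/-- A numbering of the states. -/
noncomputable def stateEquiv (k : ℕ) : State k ≃ Fin (numStates k) := Fintype.equivFin _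

/-- `State.step` on numbered states. -/
noncomputable def delta (i : Fin (k + 1)) (c : Option (Fin k)) (s : Fin (numStates k)) (v : Bool) :
    Fin (numStates k) := stateEquiv k (((stateEquiv k).symm s).step i c v)

/-- A state is accepted if the query variables other than `i` found true are exactly those in
`ν`. -/
noncomputable def accepts (ν : Finset (Fin (k + 1))) (s : Fin (numStates k)) : Bool :=
  decide (((stateEquiv k).symm s).1 = ν)

/-- The state in which no query variable has been found true yet. -/
noncomputable def startState (k : ℕ) : Fin (numStates k) := stateEquiv k (∅, false, false)

theorem foldl_delta (i : Fin (k + 1)) (W : Database k) (L : List (Fact k)) (s : State k) :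
    L.foldl (fun s t => delta i t.kind s (decide (t ∈ W))) (stateEquiv k s) =
      stateEquiv k (s.run i W L) :=
  List.foldl_hom _ fun s t => by simp [delta]

/-- The active domain of a list of facts. -/
def listConsts (l : List (Fact k)) : List ℕ := (l.flatMap Fact.consts).dedup

theorem mem_listConsts {l : List (Fact k)} {a : ℕ} :
    a ∈ listConsts l ↔ ∃ t ∈ l, a ∈ t.consts := by
  rw [listConsts, List.mem_dedup, List.mem_flatMap]

theorem length_listConsts_le (l : List (Fact k)) : (listConsts l).length ≤ 2 * l.length := by
  refine (List.dedup_sublist _).length_le.trans ?_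
  rw [List.length_flatMap, mul_comm]
  refine (List.sum_le_card_nsmul _ 2 (List.forall_mem_map.2 fun t _ => ?_)).trans (by simp)
  cases t <;> simp [Fact.consts]

open Classical in
/-- The query variables that are true in `W`. -/
noncomputable def satisfied (W : Database k) : Finset (Fin (k + 1)) := {j | hk j W}

/-- The order in which the automaton for pairs that differ in `i` reads all facts over the active
domain of `l`. -/
def readOrder (i : Fin (k + 1)) (l : List (Fact k)) : List (Fact k) := factOrder i (listConsts l)

theorem nodup_readOrder (i : Fin (k + 1)) (l : List (Fact k)) : (readOrder i l).Nodup :=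
  nodup_factOrder i (List.nodup_dedup _)

theorem mem_readOrder (i : Fin (k + 1)) {l : List (Fact k)} {t : Fact k} (h : t ∈ l) :
    t ∈ readOrder i l :=
  (mem_factOrder i _ t).2 fun _ ha => mem_listConsts.2 ⟨t, h, ha⟩

theorem length_readOrder_le (i : Fin (k + 1)) (l : List (Fact k)) :
    (readOrder i l).length ≤ 2 * ((2 * l.length) * ((2 * l.length) * k + 1)) := by
  refine (length_factOrder_le i (listConsts l)).trans ?_
  have := length_listConsts_le l
  gcongr

theorem accepts_foldl_readOrder (i : Fin (k + 1)) (ν : Finset (Fin (k + 1))) {l : List (Fact k)}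
    {W : Database k} (hW : W ⊆ l.toFinset) :
    accepts ν ((readOrder i l).foldl (fun s t => delta i t.kind s (decide (t ∈ W)))
      (startState k)) = decide ((satisfied W).erase i = ν) := by
  have hsat : (State.run i W (readOrder i l) (∅, false, false)).1 = (satisfied W).erase i := by
    ext j
    rw [readOrder, State.mem_run_factOrder, Finset.mem_erase, satisfied]
    · simp
    · intro t ht a ha
      exact mem_listConsts.2 ⟨t, List.mem_toFinset.1 (hW ht), ha⟩
  rw [startState, foldl_delta, accepts, Equiv.symm_apply_apply, hsat]

/-- The gates `G`, followed by a circuit for the query that holds if the set of true query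
variables is `ν` or `insert i ν`. -/
noncomputable def pairGates (i : Fin (k + 1)) (ν : Finset (Fin (k + 1))) (l : List (Fact k))
    (G : List (Gate (Fact k))) : List (Gate (Fact k)) :=
  automatonGates (fun t => delta i t.kind) (accepts ν) l.toFinset (readOrder i l) G

theorem captures_pairGates (i : Fin (k + 1)) (ν : Finset (Fin (k + 1))) {l : List (Fact k)}
    {G : List (Gate (Fact k))} (h : DDGates l.toFinset G) :
    DDGates l.toFinset (pairGates i ν l G) ∧
      Captures (pairGates i ν l G) ((pairGates i ν l G).length - numStates k + startState k)
        (fun W => decide ((satisfied (W ∩ l.toFinset)).erase i = ν)) Set.univ := by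
  have hcap := capturesStates_automatonGates (fun t : Fact k => delta i t.kind) (accepts ν)
    (nodup_readOrder i l) h
  refine ⟨hcap.dd, (hcap.captures (startState k)).lt, fun W => ?_, fun _ _ => trivial⟩
  rw [← accepts_foldl_readOrder i ν Finset.inter_subset_right]
  simp only [Finset.mem_inter, Bool.decide_and]
  exact (hcap.captures (startState k)).eval W

/-- The circuit `C`, with an additional gate for its negation. -/
def notCircuit (C : Circuit (Fact k)) : Circuit (Fact k) :=
  ⟨C.gates ++ [.not C.out], C.gates.length⟩

/-- The disjunction of `C` with the circuit of `pairGates`. -/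
noncomputable def addCircuit (i : Fin (k + 1)) (ν : Finset (Fin (k + 1))) (l : List (Fact k))
    (C : Circuit (Fact k)) : Circuit (Fact k) :=
  ⟨pairGates i ν l C.gates ++
    [.or [C.out, (pairGates i ν l C.gates).length - numStates k + startState k]],
    (pairGates i ν l C.gates).length⟩

/-- `C` is a d-D for the lineage of the query of `φ` on `D`. -/
def IsDDFor (φ : BoolFun (Fin (k + 1))) (D : Database k) (C : Circuit (Fact k)) : Prop :=
  C.IsDD ∧ C.RepresentsLineage (hQuery φ) D

theorem isDDFor_iff {φ : BoolFun (Fin (k + 1))} {D : Database k} {C : Circuit (Fact k)} :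
    IsDDFor φ D C ↔ DDGates D C.gates ∧
      Captures C.gates C.out (fun W => φ (satisfied (W ∩ D))) Set.univ := by
  rw [IsDDFor, Circuit.RepresentsLineage, ← and_assoc, ddGates_iff, and_assoc]
  refine and_congr_right fun hdd => ⟨fun ⟨hout, hφ⟩ => ⟨hout, fun W => ?_, fun _ _ => trivial⟩,
    fun hcap => ⟨hcap.lt, fun W hW => ?_⟩⟩
  · rw [← hdd.gateEval_inter, ← hdd.eval_eq_gateEval]
    exact Bool.eq_iff_iff.2 (hφ _ Finset.inter_subset_right)
  · rw [hdd.eval_eq_gateEval, hcap.eval, Finset.inter_eq_left.2 hW]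
    rfl

theorem IsDDFor.notCircuit {φ : BoolFun (Fin (k + 1))} {D : Database k} {C : Circuit (Fact k)}
    (h : IsDDFor φ D C) : IsDDFor (fun ν => !φ ν) D (notCircuit C) := by
  obtain ⟨hdd, hcap⟩ := isDDFor_iff.1 h
  exact isDDFor_iff.2 (hdd.append_singleton (.not D hcap))

theorem IsDDFor.addCircuit {φ : BoolFun (Fin (k + 1))} {C : Circuit (Fact k)}
    {l : List (Fact k)} (h : IsDDFor φ l.toFinset C) {i : Fin (k + 1)} {ν : Finset (Fin (k + 1))}
    (hν : ∀ μ, μ.erase i = ν → φ μ = false) :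
    IsDDFor (fun μ => φ μ || decide (μ.erase i = ν)) l.toFinset (addCircuit i ν l C) := by
  obtain ⟨hdd, hcap⟩ := isDDFor_iff.1 h
  obtain ⟨hddPair, hpair⟩ := captures_pairGates i ν hdd
  have hcapPair : Captures (pairGates i ν l C.gates) C.out
      (fun W => φ (satisfied (W ∩ l.toFinset))) Set.univ := by
    obtain ⟨G, hG⟩ := automatonGates_prefix (fun t : Fact k => delta i t.kind) (accepts ν)
      l.toFinset (readOrder i l) C.gates
    rw [pairGates, hG]
    exact hcap.append hdd G
  have hdisj (μ) : ¬ (φ μ = true ∧ decide (μ.erase i = ν) = true) := by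
    rintro ⟨hμ, hμν⟩
    exact Bool.false_ne_true ((hν μ (of_decide_eq_true hμν)).symm.trans hμ)
  have hor := hddPair.append_singleton (.or l.toFinset hcapPair hpair fun _ => hdisj _)
  rw [Set.union_self] at hor
  exact isDDFor_iff.2 hor

theorem size_notCircuit (C : Circuit (Fact k)) : (notCircuit C).size = C.size + 2 :=
  gatesSize_append C.gates [Gate.not C.out]

theorem size_addCircuit_le (i : Fin (k + 1)) (ν : Finset (Fin (k + 1))) (l : List (Fact k))
    (C : Circuit (Fact k)) :
    (addCircuit i ν l C).size ≤ C.size + numStates k +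
      2 * ((2 * l.length) * ((2 * l.length) * k + 1)) * (3 * (2 + 3 * numStates k)) + 3 := by
  refine (gatesSize_append _ _).le.trans (Nat.add_le_add_right ?_ 3)
  refine (gatesSize_automatonGates_le (fun t : Fact k => delta i t.kind) (accepts ν)
    l.toFinset (readOrder i l) C.gates).trans ?_
  gcongr
  exacts [le_rfl, length_readOrder_le i l]

theorem ddpSize_of_eul_eq {φ φ' : BoolFun (Fin (k + 1))} (h : eul φ = eul φ')
    (hφ : DDPsize (hQuery φ)) : DDPsize (hQuery φ') := by
  refine eul_induction (P := fun φ => DDPsize (hQuery φ)) ?_ ?_ h hφ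
  · rintro φ ⟨b, hb⟩
    refine ⟨b + 2, fun D => ?_⟩
    obtain ⟨C, hdd, hC, hsize⟩ := hb D
    obtain ⟨hdd', hC'⟩ := IsDDFor.notCircuit ⟨hdd, hC⟩
    exact ⟨_, hdd', hC', by simpa [size_notCircuit] using hsize⟩
  · rintro φ ν i hν ⟨b, hb⟩
    refine ⟨b + .C (numStates k) + 2 * ((2 * .X) * ((2 * .X) * .C k + 1)) *
      .C (3 * (2 + 3 * numStates k)) + 3, fun D => ?_⟩
    obtain ⟨C, hdd, hC, hsize⟩ := hb D
    rw [← Finset.toList_toFinset D] at hC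
    obtain ⟨hdd', hC'⟩ := IsDDFor.addCircuit ⟨hdd, hC⟩ hν
    rw [Finset.toList_toFinset D] at hC'
    refine ⟨_, hdd', hC', (size_addCircuit_le i ν D.toList C).trans ?_⟩
    rw [Finset.length_toList]
    simp only [Polynomial.eval_add, Polynomial.eval_mul, Polynomial.eval_X, Polynomial.eval_C,
      Polynomial.eval_one, Polynomial.eval_ofNat]
    omega

end PairQueries

/-! ### Computing the circuits in polynomial time -/

section Programs

variable {k : ℕ} {X A : Type} [Enc X] [Enc A] {Os : Set (Val → Val)}

instance : Enc Val := ⟨fun v => v⟩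

instance : Enc (Fact k) := ⟨encFact⟩

instance : Enc (Gate (Fact k)) := ⟨encGate⟩

instance : Enc (Circuit (Fact k)) := ⟨encCircuit⟩

theorem enc_fact_injective : Function.Injective (enc : Fact k → Val) := by
  intro t t' h
  change encFact t = encFact t' at h
  cases t <;> cases t' <;> simp_all [encFact, Fin.ext_iff]

namespace PolyTime

@[fun_prop]
theorem ofFn {m : ℕ} {f : X → Fin m → A} (hf : ∀ s, PolyTime Os fun x => f x s) :
    PolyTime Os fun x => List.ofFn (f x) := (pi hf).congr_enc fun _ => rfl

@[fun_prop]
theorem val_fst {f : X → Val} (hf : PolyTime Os f) : PolyTime Os fun x => (f x).fst := by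
  refine comp (g := fun v : Val => v.fst) (.of_op .fst (fun _ => rfl)
    (PolyBounded.sz_self.of_le fun v => ?_)) hf
  cases v <;> simp only [sz, enc, Val.fst, Val.size, Nat.size_zero] <;> omega

@[fun_prop]
theorem val_snd {f : X → Val} (hf : PolyTime Os f) : PolyTime Os fun x => (f x).snd := by
  refine comp (g := fun v : Val => v.snd) (.of_op .snd (fun _ => rfl)
    (PolyBounded.sz_self.of_le fun v => ?_)) hf
  cases v <;> simp only [sz, enc, Val.snd, Val.size, Nat.size_zero] <;> omega

@[fun_prop]
theorem decide_val_eq {f g : X → Val} (hf : PolyTime Os f) (hg : PolyTime Os g) :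
    PolyTime Os fun x => decide (f x = g x) := decide_eq (fun _ _ h => h) hf hg

@[fun_prop]
theorem encFact {t : X → Fact k} (ht : PolyTime Os t) : PolyTime Os fun x => HQ.encFact (t x) :=
  ht.congr_enc fun _ => rfl

theorem decide_kind_eq {t : X → Fact k} (ht : PolyTime Os t) (c : Option (Fin k)) :
    PolyTime Os fun x => decide ((t x).kind = c) := by
  have hbinary : PolyTime Os fun x => decide ((HQ.encFact (t x)).fst = .nat 1) := by fun_prop
  cases c with
  | none =>
    refine hbinary.not.congr fun x => ?_
    cases t x <;> simp [Fact.kind, HQ.encFact, Val.fst]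
  | some j =>
    have hindex : PolyTime Os fun x => decide ((HQ.encFact (t x)).snd.fst = .nat j) := by fun_prop
    refine (hbinary.and hindex).congr fun x => ?_
    cases t x <;> simp [Fact.kind, HQ.encFact, Val.fst, Val.snd, Fin.ext_iff]

@[fun_prop]
theorem fact_consts {t : X → Fact k} (ht : PolyTime Os t) :
    PolyTime Os fun x => (t x).consts := by
  have h : PolyTime Os fun x => bif decide ((HQ.encFact (t x)).fst = .nat 1) then
      [(HQ.encFact (t x)).snd.snd.fst, (HQ.encFact (t x)).snd.snd.snd]
      else [(HQ.encFact (t x)).snd] := by fun_prop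
  refine h.congr_enc fun x => ?_
  cases t x <;> rfl

@[fun_prop]
theorem fact_R {f : X → ℕ} (hf : PolyTime Os f) : PolyTime Os fun x => (Fact.R (f x) : Fact k) :=
  ((const 0).pair hf : PolyTime Os fun x => ((0 : ℕ), f x)).congr_enc fun _ => rfl

@[fun_prop]
theorem fact_T {f : X → ℕ} (hf : PolyTime Os f) : PolyTime Os fun x => (Fact.T (f x) : Fact k) :=
  ((const 2).pair hf : PolyTime Os fun x => ((2 : ℕ), f x)).congr_enc fun _ => rfl

@[fun_prop]
theorem fact_S (j : Fin k) {f g : X → ℕ} (hf : PolyTime Os f) (hg : PolyTime Os g) :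
    PolyTime Os fun x => Fact.S j (f x) (g x) :=
  ((const 1).pair ((const j.val).pair (hf.pair hg)) :
    PolyTime Os fun x => ((1 : ℕ), (j.val, (f x, g x)))).congr_enc fun _ => rfl

@[fun_prop]
theorem gate_var {t : X → Fact k} (ht : PolyTime Os t) : PolyTime Os fun x => Gate.var (t x) :=
  ((const 0).pair ht : PolyTime Os fun x => ((0 : ℕ), t x)).congr_enc fun _ => rfl

@[fun_prop]
theorem gate_not {f : X → ℕ} (hf : PolyTime Os f) :
    PolyTime Os fun x => (Gate.not (f x) : Gate (Fact k)) :=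
  ((const 1).pair hf : PolyTime Os fun x => ((1 : ℕ), f x)).congr_enc fun _ => rfl

@[fun_prop]
theorem gate_and {f : X → List ℕ} (hf : PolyTime Os f) :
    PolyTime Os fun x => (Gate.and (f x) : Gate (Fact k)) :=
  ((const 2).pair hf : PolyTime Os fun x => ((2 : ℕ), f x)).congr_enc fun _ => rfl

@[fun_prop]
theorem gate_or {f : X → List ℕ} (hf : PolyTime Os f) :
    PolyTime Os fun x => (Gate.or (f x) : Gate (Fact k)) :=
  ((const 3).pair hf : PolyTime Os fun x => ((3 : ℕ), f x)).congr_enc fun _ => rfl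

@[fun_prop]
theorem circuit_mk {G : X → List (Gate (Fact k))} {o : X → ℕ} (hG : PolyTime Os G)
    (ho : PolyTime Os o) : PolyTime Os fun x => (⟨G x, o x⟩ : Circuit (Fact k)) :=
  (hG.pair ho).congr_enc fun _ => rfl

@[fun_prop]
theorem circuit_gates {C : X → Circuit (Fact k)} (hC : PolyTime Os C) :
    PolyTime Os fun x => (C x).gates :=
  (hC.congr_enc (g := fun x => ((C x).gates, (C x).out)) fun _ => rfl).fst

@[fun_prop]
theorem circuit_out {C : X → Circuit (Fact k)} (hC : PolyTime Os C) :
    PolyTime Os fun x => (C x).out :=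
  (hC.congr_enc (g := fun x => ((C x).gates, (C x).out)) fun _ => rfl).snd

@[fun_prop]
theorem listConsts {l : X → List (Fact k)} (hl : PolyTime Os l) :
    PolyTime Os fun x => listConsts (l x) :=
  .dedup enc_nat_injective (by fun_prop)

theorem factOrder (i : Fin (k + 1)) {A : X → List ℕ} (hA : PolyTime Os A) :
    PolyTime Os fun x => factOrder i (A x) := by
  unfold HQ.factOrder sweep
  fun_prop

theorem stepLayer {m : ℕ} (δ : Option (Fin k) → Fin m → Bool → Fin m) {present : X → Bool}
    {n : X → ℕ} {t : X → Fact k} (hp : PolyTime Os present) (hn : PolyTime Os n)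
    (ht : PolyTime Os t) :
    PolyTime Os fun x => stepLayer (δ (t x).kind) (present x) (n x) (t x) := by
  refine .finite_cases (kind := fun x => (t x).kind)
    (f := fun c x => HQ.stepLayer (δ c) (present x) (n x) (t x)) ht.decide_kind_eq fun c => ?_
  simp only [HQ.stepLayer, ← Bool.cond_eq_ite]
  fun_prop

theorem pairGates (i : Fin (k + 1)) (ν : Finset (Fin (k + 1))) {l : X → List (Fact k)}
    {G : X → List (Gate (Fact k))} (hl : PolyTime Os l) (hG : PolyTime Os G) :
    PolyTime Os fun x => pairGates i ν (l x) (G x) := by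
  refine foldl_append (W := 2 + 3 * numStates k) (l := fun x => (readOrder i (l x)).reverse)
    (s := fun x => G x ++ acceptLayer (accepts ν))
    (block := fun x n t => HQ.stepLayer (delta i t.kind) (decide (t ∈ (l x).toFinset)) n t)
    (hl.listConsts.factOrder i).reverse (by fun_prop) ?_ fun x n t => (length_stepLayer _ _ _ _).le
  refine .stepLayer (delta i) ?_ (by fun_prop) (by fun_prop)
  simp only [List.mem_toFinset]
  exact .decide_mem enc_fact_injective (by fun_prop) (by fun_prop)

theorem notCircuit {C : X → Circuit (Fact k)} (hC : PolyTime Os C) :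
    PolyTime Os fun x => notCircuit (C x) := by
  unfold HQ.notCircuit
  fun_prop

theorem addCircuit (i : Fin (k + 1)) (ν : Finset (Fin (k + 1))) {l : X → List (Fact k)}
    {C : X → Circuit (Fact k)} (hl : PolyTime Os l) (hC : PolyTime Os C) :
    PolyTime Os fun x => addCircuit i ν (l x) (C x) := by
  have hG := hl.pairGates i ν hC.circuit_gates
  unfold HQ.addCircuit
  fun_prop

end PolyTime

/-- The lists that represent databases in the inputs of algorithms. -/
abbrev FactList (k : ℕ) := {l : List (Fact k) // l.Nodup}

instance : Enc (FactList k) := ⟨fun l => enc l.1⟩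

theorem ddpTime_iff {φ : BoolFun (Fin (k + 1))} : DDPtime (hQuery φ) ↔
    ∃ C : FactList k → Circuit (Fact k), PolyTime {noOracle} C ∧
      ∀ l, IsDDFor φ l.1.toFinset (C l) := by
  constructor
  · rintro ⟨p, b, h⟩
    choose C hdd hC hp using fun l : FactList k => h l.1.toFinset l.1 ⟨l.2, rfl⟩
    refine ⟨C, .of_polynomial (Set.mem_singleton _) p b ?_, fun l => ⟨hdd l, hC l⟩⟩
    rintro O rfl l
    exact hp l
  · rintro ⟨C, hC, hdd⟩
    obtain ⟨p, b, hp⟩ := hC.exists_polynomial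
    refine ⟨p, b, ?_⟩
    rintro D l ⟨hl, rfl⟩
    exact ⟨C ⟨l, hl⟩, (hdd ⟨l, hl⟩).1, (hdd ⟨l, hl⟩).2, hp noOracle rfl ⟨l, hl⟩⟩

theorem ddpTime_of_eul_eq {φ φ' : BoolFun (Fin (k + 1))} (h : eul φ = eul φ')
    (hφ : DDPtime (hQuery φ)) : DDPtime (hQuery φ') := by
  rw [ddpTime_iff] at hφ ⊢
  refine eul_induction (P := fun φ => ∃ C : FactList k → Circuit (Fact k),
    PolyTime {noOracle} C ∧ ∀ l, IsDDFor φ l.1.toFinset (C l)) ?_ ?_ h hφ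
  · rintro φ ⟨C, hC, h⟩
    exact ⟨_, hC.notCircuit, fun l => (h l).notCircuit⟩
  · rintro φ ν i hν ⟨C, hC, h⟩
    have hl : PolyTime {noOracle} fun l : FactList k => l.1 := .of_enc_eq fun _ => rfl
    exact ⟨_, hl.addCircuit i ν hC, fun l => (h l).addCircuit hν⟩

end Programs

/-! ### Probabilities -/

section Weights

variable {F R : Type*} [DecidableEq F] [CommRing R] {p : F → R} {D W : Finset F} {t : F}

/-- The probability that the true elements of `D` are exactly those in `W`, if the elements `t` are
true independently with probability `p t`. -/
def worldWeight (p : F → R) (D W : Finset F) : R := (∏ t ∈ W, p t) * ∏ t ∈ D \ W, (1 - p t)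

theorem worldWeight_insert (ht : t ∉ W) (htD : t ∉ D) :
    worldWeight p (insert t D) W = (1 - p t) * worldWeight p D W := by
  rw [worldWeight, worldWeight, Finset.insert_sdiff_of_notMem D ht,
    Finset.prod_insert (by simp [htD]), mul_left_comm]

theorem worldWeight_insert_insert (ht : t ∉ W) (htD : t ∉ D) :
    worldWeight p (insert t D) (insert t W) = p t * worldWeight p D W := by
  rw [worldWeight, worldWeight, Finset.insert_sdiff_insert, Finset.sdiff_insert_of_notMem htD,
    Finset.prod_insert ht, mul_assoc]

theorem sum_worldWeight (p : F → R) (D : Finset F) : ∑ W ∈ D.powerset, worldWeight p D W = 1 :=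
  (Finset.prod_add p (fun t => 1 - p t) D).symm.trans (by simp)

theorem sum_worldWeight_of_subset {L : Finset F} (h : D ⊆ L) (f : Finset F → R) :
    ∑ W ∈ L.powerset, worldWeight (fun t => if t ∈ D then p t else 0) L W * f W =
      ∑ W ∈ D.powerset, worldWeight p D W * f W := by
  refine (Finset.sum_subset (Finset.powerset_mono.2 h) fun W _ hW => ?_).symm.trans
    (Finset.sum_congr rfl fun W hW => ?_)
  · obtain ⟨t, ht, htD⟩ := Finset.not_subset.1 (mt Finset.mem_powerset.2 hW)
    rw [worldWeight, Finset.prod_eq_zero ht (if_neg htD), zero_mul, zero_mul]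
  · rw [Finset.mem_powerset] at hW
    have hfalse : ∏ t ∈ D \ W, (1 - p t) = ∏ t ∈ L \ W, (1 - if t ∈ D then p t else 0) := by
      refine Finset.prod_subset_one_on_sdiff (Finset.sdiff_subset_sdiff h le_rfl)
        (fun t ht => ?_) fun t ht => by rw [if_pos (Finset.mem_sdiff.1 ht).1]
      simp only [Finset.mem_sdiff] at ht
      rw [if_neg fun h => ht.2 ⟨h, ht.1.2⟩, sub_zero]
    rw [worldWeight, worldWeight, ← hfalse, Finset.prod_congr rfl fun t ht => if_pos (hW ht)]

/-- The probability that an automaton accepts the elements of a list, if the elements `t` are true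
independently with probability `p t`. -/
def acceptProb {S : Type*} (p : F → R) (δ : F → S → Bool → S) (acc : S → Bool) : List F → S → R
  | [], s => if acc s then 1 else 0
  | t :: L, s => p t * acceptProb p δ acc L (δ t s true) +
      (1 - p t) * acceptProb p δ acc L (δ t s false)

theorem acceptProb_eq_sum {S : Type*} (p : F → R) (δ : F → S → Bool → S) (acc : S → Bool)
    {L : List F} (hL : L.Nodup) (s : S) :
    acceptProb p δ acc L s = ∑ W ∈ L.toFinset.powerset, worldWeight p L.toFinset W *
      if acc (L.foldl (fun s t => δ t s (decide (t ∈ W))) s) then 1 else 0 := by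
  induction L generalizing s with
  | nil => cases h : acc s <;> simp [acceptProb, worldWeight, h]
  | cons t L ih =>
    obtain ⟨htL, hL⟩ := List.nodup_cons.1 hL
    have htD : t ∉ L.toFinset := mt List.mem_toFinset.1 htL
    rw [acceptProb, ih hL, ih hL, List.toFinset_cons, Finset.sum_powerset_insert htD, add_comm,
      Finset.mul_sum, Finset.mul_sum]
    congr 1 <;> refine Finset.sum_congr rfl fun W hW => ?_ <;>
      have htW : t ∉ W := fun h => htD (Finset.mem_powerset.1 hW h)
    · rw [worldWeight_insert htW htD, mul_assoc, List.foldl_cons, decide_eq_false htW]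
    · have hrest (s : S) : L.foldl (fun s t' => δ t' s (decide (t' ∈ insert t W))) s =
          L.foldl (fun s t' => δ t' s (decide (t' ∈ W))) s :=
        List.foldl_ext _ _ _ fun s t' ht' => by
          have hne : t' ≠ t := ne_of_mem_of_not_mem ht' htL
          simp [hne]
      rw [worldWeight_insert_insert htW htD, mul_assoc, List.foldl_cons, hrest,
        decide_eq_true (Finset.mem_insert_self t W)]

end Weights

namespace TID

variable {k : ℕ} (I : TID k) (φ : BoolFun (Fin (k + 1)))

theorem prob_hQuery : I.prob (hQuery φ) =
    ∑ W ∈ I.D.powerset, worldWeight I.π I.D W * if φ (satisfied W) then 1 else 0 := by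
  rw [TID.prob, Finset.sum_filter]
  refine Finset.sum_congr rfl fun W _ => ?_
  rw [mul_ite, mul_one, mul_zero]
  congr 1

theorem prob_nonneg : 0 ≤ I.prob (hQuery φ) := by
  rw [prob_hQuery]
  refine Finset.sum_nonneg fun W hW => mul_nonneg (mul_nonneg
    (Finset.prod_nonneg fun t ht => I.nonneg t (Finset.mem_powerset.1 hW ht))
    (Finset.prod_nonneg fun t ht => sub_nonneg.2 (I.le_one t (Finset.mem_sdiff.1 ht).1))) ?_
  split_ifs <;> norm_num

theorem prob_not : I.prob (hQuery fun ν => !φ ν) = 1 - I.prob (hQuery φ) := by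
  rw [prob_hQuery, prob_hQuery, eq_sub_iff_add_eq, ← Finset.sum_add_distrib]
  refine (Finset.sum_congr rfl fun W _ => ?_).trans (sum_worldWeight I.π I.D)
  cases φ (satisfied W) <;> simp

theorem prob_le_one : I.prob (hQuery φ) ≤ 1 := by
  have hnot := I.prob_not φ
  have hnonneg := I.prob_nonneg fun ν => !φ ν
  linarith

theorem prob_or {φ ψ : BoolFun (Fin (k + 1))} (h : ∀ ν, ψ ν = true → φ ν = false) :
    I.prob (hQuery fun ν => φ ν || ψ ν) = I.prob (hQuery φ) + I.prob (hQuery ψ) := by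
  rw [prob_hQuery, prob_hQuery, prob_hQuery, ← Finset.sum_add_distrib]
  refine Finset.sum_congr rfl fun W _ => ?_
  cases hψ : ψ (satisfied W)
  · simp
  · simp [h _ hψ]

theorem prob_erase_eq (i : Fin (k + 1)) (ν : Finset (Fin (k + 1))) {l : List (Fact k)}
    (hl : l.toFinset = I.D) :
    I.prob (hQuery fun μ => decide (μ.erase i = ν)) =
      acceptProb (fun t => if t ∈ I.D then I.π t else 0) (fun t => delta i t.kind) (accepts ν)
        (readOrder i l) (startState k) := by
  have hsub : I.D ⊆ (readOrder i l).toFinset := fun t ht =>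
    List.mem_toFinset.2 (mem_readOrder i (List.mem_toFinset.1 (hl ▸ ht)))
  rw [prob_hQuery, acceptProb_eq_sum _ _ _ (nodup_readOrder i l), sum_worldWeight_of_subset hsub]
  refine Finset.sum_congr rfl fun W hW => ?_
  rw [accepts_foldl_readOrder i ν (hl ▸ Finset.mem_powerset.1 hW)]

theorem den_worldProb_dvd {W : Database k} (hW : W ⊆ I.D) :
    (I.worldProb W).den ∣ ∏ t ∈ I.D, (I.π t).den := by
  rw [← Finset.prod_sdiff hW, mul_comm]
  refine (Rat.mul_den_dvd _ _).trans (mul_dvd_mul (Finset.Rat.den_prod_dvd_prod_den _ _) ?_)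
  refine (Finset.Rat.den_prod_dvd_prod_den _ _).trans
    (Finset.prod_dvd_prod_of_dvd _ _ fun t _ => ?_)
  simpa only [Rat.den_one, one_mul] using Rat.sub_den_dvd 1 (I.π t)

open Classical in
theorem den_prob_dvd (Q : BoolQuery k) : (I.prob Q).den ∣ ∏ t ∈ I.D, (I.π t).den :=
  (Finset.Rat.den_sum_dvd_lcm_den _ _).trans <| Finset.lcm_dvd fun _ hW =>
    I.den_worldProb_dvd (Finset.mem_powerset.1 (Finset.mem_filter.1 hW).1)

end TID

/-! ### Computing the probabilities in polynomial time -/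

section RationalArithmetic

variable {q : ℚ}

theorem toNat_num_le_den (h : q ≤ 1) : q.num.toNat ≤ q.den := by
  have := Rat.num_le_denom_iff.2 h
  omega

theorem toNat_num_div_den (h : 0 ≤ q) : (q.num.toNat : ℚ) / q.den = q := by
  have hnum : ((q.num.toNat : ℤ) : ℚ) = q.num := by rw [Int.toNat_of_nonneg (Rat.num_nonneg.2 h)]
  rw [← Int.cast_natCast, hnum, Rat.num_div_den]

theorem sz_rat (q : ℚ) :
    sz q = Nat.size q.num.toNat + Nat.size (-q.num).toNat + Nat.size q.den + 5 := by
  change (Val.pair (.pair (.nat _) (.nat _)) (.nat _)).size = _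
  simp only [Val.size]
  omega

theorem sz_rat_le (h₀ : 0 ≤ q) (h₁ : q ≤ 1) : sz q ≤ 2 * Nat.size q.den + 5 := by
  have hneg : (-q.num).toNat = 0 := Int.toNat_of_nonpos (neg_nonpos.2 (Rat.num_nonneg.2 h₀))
  have hnum := Nat.size_le_size (toNat_num_le_den h₁)
  rw [sz_rat, hneg, Nat.size_zero]
  omega

namespace PolyTime

variable {X : Type} [Enc X] {Os : Set (Val → Val)} {f g : X → ℚ}

theorem rat_add (hf : PolyTime Os f) (hg : PolyTime Os g) (hf₀ : ∀ x, 0 ≤ f x)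
    (hg₀ : ∀ x, 0 ≤ g x) : PolyTime Os fun x => f x + g x := by
  have h : PolyTime Os fun x =>
      (((f x).num.toNat * (g x).den + (f x).den * (g x).num.toNat : ℕ) : ℚ) /
        ((f x).den * (g x).den : ℕ) := by fun_prop
  refine h.congr fun x => ?_
  conv_lhs => rw [← toNat_num_div_den (hf₀ x), ← toNat_num_div_den (hg₀ x)]
  rw [div_add_div _ _ (Nat.cast_ne_zero.2 (f x).den_nz) (Nat.cast_ne_zero.2 (g x).den_nz)]
  push_cast
  rfl

theorem one_sub (hf : PolyTime Os f) (hf₀ : ∀ x, 0 ≤ f x) (hf₁ : ∀ x, f x ≤ 1) :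
    PolyTime Os fun x => 1 - f x := by
  have h : PolyTime Os fun x => (((f x).den - (f x).num.toNat : ℕ) : ℚ) / (f x).den := by fun_prop
  refine h.congr fun x => ?_
  rw [Nat.cast_sub (toNat_num_le_den (hf₁ x)), sub_div, toNat_num_div_den (hf₀ x),
    div_self (Nat.cast_ne_zero.2 (f x).den_nz)]

end PolyTime

end RationalArithmetic

section Table

variable {F : Type*} {m : ℕ} (p : F → ℚ) (δ : F → Fin m → Bool → Fin m) (acc : Fin m → Bool)

/-- One step of the computation of the acceptance probabilities from all states, which are
represented by their numerators and a common denominator. -/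
def tableStep (q : ℚ) (next : Fin m → Bool → Fin m) (N : (Fin m → ℕ) × ℕ) : (Fin m → ℕ) × ℕ :=
  (fun s => q.num.toNat * N.1 (next s true) + (q.den - q.num.toNat) * N.1 (next s false),
    q.den * N.2)

/-- The probabilities of `acceptProb` from all states, with a common denominator that need not be
the least one. -/
def acceptTable (L : List F) : (Fin m → ℕ) × ℕ :=
  L.foldr (fun t => tableStep (p t) (δ t)) (fun s => (acc s).toNat, 1)

theorem acceptTable_pos (L : List F) : 0 < (acceptTable p δ acc L).2 := by
  induction L with
  | nil => exact Nat.one_pos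
  | cons t L ih => exact Nat.mul_pos (p t).den_pos ih

variable {p}

theorem acceptTable_le (h₁ : ∀ t, p t ≤ 1) (L : List F) (s : Fin m) :
    (acceptTable p δ acc L).1 s ≤ (acceptTable p δ acc L).2 := by
  induction L generalizing s with
  | nil => exact Bool.toNat_le (acc s)
  | cons t L ih =>
    change _ * _ + _ * _ ≤ (p t).den * (acceptTable p δ acc L).2
    rw [← Nat.add_sub_cancel' (toNat_num_le_den (h₁ t)), add_mul, Nat.add_sub_cancel_left]
    exact add_le_add (Nat.mul_le_mul_left _ (ih _)) (Nat.mul_le_mul_left _ (ih _))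

theorem acceptTable_div (h₀ : ∀ t, 0 ≤ p t) (h₁ : ∀ t, p t ≤ 1) (L : List F) (s : Fin m) :
    ((acceptTable p δ acc L).1 s : ℚ) / (acceptTable p δ acc L).2 = acceptProb p δ acc L s := by
  induction L generalizing s with
  | nil => cases h : acc s <;> simp [acceptTable, acceptProb, h]
  | cons t L ih =>
    have hN : ((acceptTable p δ acc L).2 : ℚ) ≠ 0 :=
      Nat.cast_ne_zero.2 (acceptTable_pos p δ acc L).ne'
    have hd : ((p t).den : ℚ) ≠ 0 := Nat.cast_ne_zero.2 (p t).den_nz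
    have hp : p t = (p t).num.toNat / (p t).den := (toNat_num_div_den (h₀ t)).symm
    have hle := toNat_num_le_den (h₁ t)
    change (((p t).num.toNat * (acceptTable p δ acc L).1 (δ t s true) +
      ((p t).den - (p t).num.toNat) * (acceptTable p δ acc L).1 (δ t s false) : ℕ) : ℚ) /
      ((p t).den * (acceptTable p δ acc L).2 : ℕ) = _
    rw [acceptProb, ← ih, ← ih]
    generalize (p t).num.toNat = a, (p t).den = d at *
    rw [hp]
    push_cast [Nat.cast_sub hle]
    field_simp

theorem size_acceptTable_le {c : ℕ} (hc : ∀ t, sz (p t) ≤ c) (L : List F) :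
    Nat.size (acceptTable p δ acc L).2 ≤ L.length * c + 1 := by
  induction L with
  | nil => simp [acceptTable]
  | cons t L ih =>
    have hmul := size_mul_le (p t).den (acceptTable p δ acc L).2
    have ht := hc t
    rw [sz_rat] at ht
    change Nat.size ((p t).den * (acceptTable p δ acc L).2) ≤ _
    rw [List.length_cons, add_mul]
    omega

theorem sz_acceptTable_le (h₁ : ∀ t, p t ≤ 1) {c : ℕ} (hc : ∀ t, sz (p t) ≤ c) (L : List F) :
    sz (acceptTable p δ acc L) ≤ (m + 1) * (L.length * c + 3) + 1 := by
  have hden := size_acceptTable_le δ acc hc L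
  have hnum : sz (acceptTable p δ acc L).1 ≤ m * (L.length * c + 3) + 1 := by
    refine (sz_list_le (c := L.length * c + 2) fun n hn => ?_).trans_eq (by rw [List.length_ofFn])
    obtain ⟨s, rfl⟩ := List.mem_ofFn.1 hn
    have hs := Nat.size_le_size (acceptTable_le δ acc h₁ L s)
    rw [sz_nat]
    omega
  rw [sz_prod, sz_nat, add_mul, one_mul]
  omega

end Table

section Reductions

variable {k : ℕ} {X : Type} [Enc X] {Os : Set (Val → Val)}

namespace PolyTime

theorem acceptTable {m : ℕ} (δ : Option (Fin k) → Fin m → Bool → Fin m) (acc : Fin m → Bool)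
    {p : X → Fact k → ℚ} {l : X → List (Fact k)} {c : X → ℕ}
    (hp : PolyTime Os fun q : X × Fact k => p q.1 q.2) (hl : PolyTime Os l)
    (hp₁ : ∀ x t, p x t ≤ 1) (hc : PolyBounded c) (hpc : ∀ x t, sz (p x t) ≤ c x) :
    PolyTime Os fun x => acceptTable (p x) (fun t => δ t.kind) acc (l x) := by
  have := hl.polyBounded_sz
  refine (hl.reverse.foldl (const (fun s => (acc s).toNat, 1))
    (step := fun x N t => tableStep (p x t) (δ t.kind) N)
    (bound := fun x => (m + 1) * (sz (l x) * c x + 3) + 1) ?_ (by fun_prop)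
    fun x l' hl' => ?_).congr fun x => (List.foldl_reverse ..).symm
  · refine .finite_cases (kind := fun q : X × ((Fin m → ℕ) × ℕ) × Fact k => q.2.2.kind)
      (f := fun c q => tableStep (p q.1 q.2.2) (δ c) q.2.1) id.snd.snd.decide_kind_eq fun c => ?_
    have : PolyTime Os fun q : X × ((Fin m → ℕ) × ℕ) × Fact k => p q.1 q.2.2 :=
      hp.comp (id.fst.pair id.snd.snd)
    unfold tableStep
    fun_prop
  · have hlen : l'.length ≤ sz (l x) := by
      simpa using hl'.length_le.trans (by simpa using (length_lt_sz (l x)).le)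
    rw [← List.foldr_reverse]
    refine (sz_acceptTable_le (fun t => δ t.kind) acc (hp₁ x) (hpc x) l'.reverse).trans ?_
    rw [List.length_reverse]
    gcongr

theorem acceptProb {m : ℕ} (δ : Option (Fin k) → Fin m → Bool → Fin m) (acc : Fin m → Bool)
    (s : Fin m) {p : X → Fact k → ℚ} {l : X → List (Fact k)} {c : X → ℕ}
    (hp : PolyTime Os fun q : X × Fact k => p q.1 q.2) (hl : PolyTime Os l)
    (hp₀ : ∀ x t, 0 ≤ p x t) (hp₁ : ∀ x t, p x t ≤ 1) (hc : PolyBounded c)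
    (hpc : ∀ x t, sz (p x t) ≤ c x) :
    PolyTime Os fun x => acceptProb (p x) (fun t => δ t.kind) acc (l x) s := by
  have h := acceptTable δ acc hp hl hp₁ hc hpc
  exact (((PolyTime.apply s).comp h.fst).natCast_div h.snd).congr fun x =>
    (acceptTable_div (fun t => δ t.kind) acc (hp₀ x) (hp₁ x) (l x) s).symm

end PolyTime

/-- Tuple-independent databases with an enumeration of their facts, as the inputs of algorithms. -/
abbrev TIDList (k : ℕ) := {x : TID k × List (Fact k) // Lists x.2 x.1.D}

instance : Enc (TIDList k) := ⟨fun x => encTID x.1.2 x.1.1.π⟩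

namespace TIDList

/-- The facts with their probabilities. -/
def pairs (x : TIDList k) : List (Fact k × ℚ) := x.1.2.map fun t => (t, x.1.1.π t)

theorem enc_pairs (x : TIDList k) : enc x.pairs = enc x := congrArg encList (List.map_map ..)

/-- The probability of a fact, which is zero outside the database. -/
def extProb (x : TIDList k) (t : Fact k) : ℚ := if t ∈ x.1.1.D then x.1.1.π t else 0

theorem extProb_nonneg (x : TIDList k) (t : Fact k) : 0 ≤ x.extProb t := by
  rw [extProb]
  split_ifs with h
  exacts [x.1.1.nonneg t h, le_rfl]

theorem extProb_le_one (x : TIDList k) (t : Fact k) : x.extProb t ≤ 1 := by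
  rw [extProb]
  split_ifs with h
  exacts [x.1.1.le_one t h, zero_le_one]

theorem sz_extProb_le (x : TIDList k) (t : Fact k) : sz (x.extProb t) ≤ sz x + sz (0 : ℚ) := by
  rw [extProb]
  split_ifs with h
  · rw [← x.2.2, List.mem_toFinset] at h
    have hmem : sz (t, x.1.1.π t) ≤ sz x.pairs := sz_le_of_mem (List.mem_map.2 ⟨t, h, rfl⟩)
    have hpairs : sz x.pairs = sz x := congrArg Val.size x.enc_pairs
    rw [sz_prod] at hmem
    dsimp only at hmem
    omega
  · exact Nat.le_add_left _ _

theorem foldl_pairs (x : TIDList k) (t : Fact k) :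
    x.pairs.foldl (fun q y => bif decide (y.1 = t) then y.2 else q) 0 = x.extProb t := by
  have hfold (l : List (Fact k)) (q : ℚ) : (l.map fun t => (t, x.1.1.π t)).foldl
      (fun q y => bif decide (y.1 = t) then y.2 else q) q = if t ∈ l then x.1.1.π t else q := by
    induction l generalizing q with
    | nil => simp
    | cons t' l ih =>
      rw [List.map_cons, List.foldl_cons, ih]
      by_cases h : t' = t
      · simp [h]
      · simp [h, Ne.symm h]
  rw [pairs, hfold, extProb, ← x.2.2]
  simp only [List.mem_toFinset]

theorem size_prod_den_le (x : TIDList k) :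
    Nat.size (∏ t ∈ x.1.1.D, (x.1.1.π t).den) ≤ sz x := by
  have hlist (l : List (Fact k)) : Nat.size (l.map fun t => (x.1.1.π t).den).prod ≤
      sz (l.map fun t => (t, x.1.1.π t)) := by
    induction l with
    | nil => simp [sz_nil]
    | cons t l ih =>
      have hmul := size_mul_le (x.1.1.π t).den (l.map fun t => (x.1.1.π t).den).prod
      rw [List.map_cons, List.prod_cons, List.map_cons, sz_cons, sz_prod, sz_rat]
      dsimp only
      omega
  rw [← x.2.2, List.prod_toFinset _ x.2.1]
  exact (hlist x.1.2).trans_eq (congrArg Val.size x.enc_pairs)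

theorem sz_prob_le (x : TIDList k) (φ : BoolFun (Fin (k + 1))) :
    sz (x.1.1.prob (hQuery φ)) ≤ 2 * sz x + 5 := by
  have hden : (x.1.1.prob (hQuery φ)).den ≤ ∏ t ∈ x.1.1.D, (x.1.1.π t).den :=
    Nat.le_of_dvd (Finset.prod_pos fun t _ => (x.1.1.π t).den_pos) (x.1.1.den_prob_dvd _)
  refine (sz_rat_le (x.1.1.prob_nonneg φ) (x.1.1.prob_le_one φ)).trans ?_
  have := (Nat.size_le_size hden).trans x.size_prod_den_le
  omega

end TIDList

namespace PolyTime

theorem tidList_pairs : PolyTime Os fun x : TIDList k => x.pairs := .of_enc_eq TIDList.enc_pairs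

theorem tidList_facts : PolyTime Os fun x : TIDList k => x.1.2 :=
  (tidList_pairs.map (f := fun _ y => y.1) id.snd.fst).congr fun x => by
    rw [TIDList.pairs, List.map_map]
    exact (List.map_id _).symm

theorem tidList_extProb : PolyTime Os fun q : TIDList k × Fact k => q.1.extProb q.2 := by
  refine ((tidList_pairs.comp id.fst).foldl_of_growth (const 0)
    (step := fun q r y => bif decide (y.1 = q.2) then y.2 else r) (growth := fun y => sz y)
    ((decide_eq enc_fact_injective (by fun_prop) (by fun_prop)).cond (by fun_prop) (by fun_prop))
    .sz_self fun q r y => ?_).congr fun q => (q.1.foldl_pairs q.2).symm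
  have hy : sz (q, y) = sz q + (sz y.1 + sz y.2 + 1) + 1 := rfl
  cases decide (y.1 = q.2) <;> simp only [cond_true, cond_false] <;> omega

theorem prob_erase_eq (i : Fin (k + 1)) (ν : Finset (Fin (k + 1))) :
    PolyTime Os fun x : TIDList k => x.1.1.prob (hQuery fun μ => decide (μ.erase i = ν)) := by
  have horder : PolyTime Os fun x : TIDList k => readOrder i x.1.2 :=
    tidList_facts.listConsts.factOrder i
  exact (acceptProb (delta i) (accepts ν) (startState k) tidList_extProb horder
    TIDList.extProb_nonneg TIDList.extProb_le_one (c := fun x => sz x + sz (0 : ℚ)) (by fun_prop)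
    TIDList.sz_extProb_le).congr fun x => x.1.1.prob_erase_eq i ν x.2.2

theorem prob_of_eul_eq {φ φ' : BoolFun (Fin (k + 1))} (h : eul φ = eul φ')
    (hφ : PolyTime Os fun x : TIDList k => x.1.1.prob (hQuery φ)) :
    PolyTime Os fun x : TIDList k => x.1.1.prob (hQuery φ') := by
  refine eul_induction (P := fun φ => PolyTime Os fun x : TIDList k => x.1.1.prob (hQuery φ))
    (fun φ hφ => ?_) (fun φ ν i hν hφ => ?_) h hφ
  · exact (hφ.one_sub (fun x => x.1.1.prob_nonneg φ) fun x => x.1.1.prob_le_one φ).congr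
      fun x => x.1.1.prob_not φ
  · exact (hφ.rat_add (prob_erase_eq i ν) (fun x => x.1.1.prob_nonneg φ)
      fun x => x.1.1.prob_nonneg _).congr
        fun x => x.1.1.prob_or fun μ hμ => hν μ (of_decide_eq_true hμ)

end PolyTime

theorem pqe_iff (Q : BoolQuery k) (v w : Val) :
    PQE Q v w ↔ ∃ x : TIDList k, v = enc x ∧ w = enc (x.1.1.prob Q) := by
  constructor
  · rintro ⟨I, l, hl, rfl, rfl⟩
    exact ⟨⟨(I, l), hl⟩, rfl, rfl⟩
  · rintro ⟨x, rfl, rfl⟩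
    exact ⟨x.1.1, x.1.2, x.2, rfl, rfl⟩

theorem turingReducible_of_eul_eq {φ φ' : BoolFun (Fin (k + 1))} (h : eul φ = eul φ') :
    TuringReducible (PQE (hQuery φ')) (PQE (hQuery φ)) := by
  have hφ : PolyTime {O | ∀ v w, PQE (hQuery φ) v w → O v = w}
      fun x : TIDList k => x.1.1.prob (hQuery φ) := by
    have hsz : PolyBounded fun x : TIDList k => sz (x.1.1.prob (hQuery φ)) :=
      PolyBounded.of_le (v := fun x => 2 * sz x + 5) (by fun_prop) fun x => x.sz_prob_le φ
    refine .of_runs .oracle hsz (PolyBounded.sz_self.add hsz) fun O hO x => ?_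
    have hx : O (enc x) = enc (x.1.1.prob (hQuery φ)) := hO _ _ ((pqe_iff _ _ _).2 ⟨x, rfl, rfl⟩)
    exact ⟨_, (congrArg (sz x + Val.size ·) hx).le, hx ▸ Runs.oracle (enc x)⟩
  obtain ⟨p, b, hp⟩ := (PolyTime.prob_of_eul_eq h hφ).exists_polynomial
  refine ⟨p, b, fun O hO v w hvw => ?_⟩
  obtain ⟨x, rfl, rfl⟩ := (pqe_iff _ _ _).1 hvw
  exact hp O hO x

end Reductions

end HQ

theorem mainTheorem7 (k : ℕ) (hk : 1 ≤ k) (φ φ' : HQ.BoolFun (Fin (k + 1)))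
    (heul : HQ.eul φ = HQ.eul φ') :
    HQ.TuringEquivalent (HQ.PQE (HQ.hQuery φ)) (HQ.PQE (HQ.hQuery φ')) ∧
    (HQ.DDPtime (HQ.hQuery φ) ↔ HQ.DDPtime (HQ.hQuery φ')) ∧
    (HQ.DDPsize (HQ.hQuery φ) ↔ HQ.DDPsize (HQ.hQuery φ')) :=
  ⟨⟨HQ.turingReducible_of_eul_eq heul.symm, HQ.turingReducible_of_eul_eq heul⟩,
    ⟨HQ.ddpTime_of_eul_eq heul, HQ.ddpTime_of_eul_eq heul.symm⟩,
    ⟨HQ.ddpSize_of_eul_eq heul, HQ.ddpSize_of_eul_eq heul.symm⟩⟩
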